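/- Let $p$ and $q$ be distinct primes with $p\ge 3\ge q$, let $G=\mathbb{Z}_p\times\mathbb{Z}_q\times\mathbb{Z}_q$, let $S$ be a proper subset of $G\setminus\{0\}$ that generates $G$, put $S_0=S\cup\{0\}$, and let $C\subseteq G$ with $0\in C$. Let $\mathrm{Cay}(G,S)$ be the directed graph with vertex set $G$ and an arc from $x$ to $y$ if and only if $y-x\in S$ (undirected if $S=-S$); $C$ is a perfect code in it if for every $g\in G$ there is exactly one $u\in C$ such that $u=g$ or there is an arc from $u$ to $g$. Write $\mathbf{e}_1=(1,0,0)$ and $[n]=\{0,1,\dots,n-1\}$. Then $C$ is a perfect code in $\mathrm{Cay}(G,S)$ if and only if there are two generators $\mathbf{v}_2,\mathbf{v}_3$ of the subgroup $\{0\}\times\mathbb{Z}_q\times\mathbb{Z}_q$ such that $(S_0,C)$ is one of the following pairs, for some integers $\alpha_i,\beta_i,\gamma_i,\alpha_{ij}$ with $\alpha_0=\beta_0=\gamma_0=\alpha_{00}=0$: 1. $S_0=\{i\mathbf{e}_1+\alpha_i\mathbf{v}_2+\beta_i\mathbf{v}_3 : i\in[p]\}$ and $C=\{i\mathbf{v}_2+j\mathbf{v}_3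 : i,j\in[q]\}$; 2. $q=3$, $S_0=\{\alpha_i\mathbf{e}_1+\alpha_i\mathbf{v}_2+i\mathbf{v}_3 : i\in[3]\}$ and $C=\{i\mathbf{e}_1+j\mathbf{v}_2 : i\in[p],\ j\in[3]\}$; 3. $q=3$, $S_0=\{j\mathbf{e}_1+\alpha_i\mathbf{v}_2+i\mathbf{v}_3 : i\in[3],\ j\in[p]\}$ and $C=\{\gamma_i\mathbf{e}_1+i\mathbf{v}_2 : i\in[3]\}$; 4. $S_0=\{i\mathbf{e}_1+j\mathbf{v}_2+\alpha_i\mathbf{v}_3 : i\in[p],\ j\in[q]\}$ and $C=\{\gamma_i\mathbf{v}_2+i\mathbf{v}_3 : i\in[q]\}$; 5. $S_0=\{i\mathbf{e}_1+\alpha_{ij}\mathbf{v}_2+j\mathbf{v}_3 : i\in[p],\ j\in[q]\}$ and $C=\{i\mathbf{v}_2 : i\in[q]\}$; 6. $S_0=\{\alpha_i\mathbf{e}_1+j\mathbf{v}_2+i\mathbf{v}_3 : i,j\in[q]\}$ and $C=\{i\mathbf{e}_1+\gamma_i\mathbf{v}_2 : i\in[p]\}$; 7. $S_0=\{\alpha_{ij}\mathbf{e}_1+i\mathbf{v}_2+j\mathbf{v}_3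 : i,j\in[q]\}$ and $C=\{i\mathbf{e}_1 : i\in[p]\}$. -/

import Mathlib

/-- The (directed) Cayley graph of an additive group `G` with connection set `S`: there is an arc
from `x` to `y` if and only if `y - x ∈ S`. -/
def cayleyDigraph {G : Type*} [AddGroup G] (S : Set G) : Digraph G where
  Adj x y := y - x ∈ S

/-- `C` is a perfect code in the directed graph `Γ`: every vertex is at directed distance at most
one from exactly one vertex of `C`, that is, the closed out-neighbourhoods of the vertices of `C`
partition the vertex set. -/
def IsPerfectCode {V : Type*} (Γ : Digraph V) (C : Set V) : Prop :=
  ∀ v : V, ∃! u : V, u ∈ C ∧ (u = v ∨ Γ.Adj u v)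

/-- The group `ℤ_p × ℤ_q × ℤ_q`. -/
abbrev Zpqq (p q : ℕ) : Type := ZMod p × ZMod q × ZMod q

/-- The element of `ℤ_p × ℤ_q × ℤ_q` with `1` in the first coordinate and `0` elsewhere. -/
def e1 (p q : ℕ) : Zpqq p q := (1, 0, 0)

/-- `v₂, v₃` are two generators of the subgroup `{0} × ℤ_q × ℤ_q`. -/
def IsGeneratingPair {p q : ℕ} (v₂ v₃ : Zpqq p q) : Prop :=
  AddSubgroup.closure {v₂, v₃} =
    (⊥ : AddSubgroup (ZMod p)).prod (⊤ : AddSubgroup (ZMod q × ZMod q))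

/-- The table of the seven families of pairs `(S₀, C)`, written with respect to `v₁` (the first
standard generator) and two elements `v₂`, `v₃`. The integers `a`, `b` appear in `S₀`, the integers
`c` appear in `C`, and they are chosen independently. The second and third family are
present only when `q = 3`. -/
def IsTablePair (p q : ℕ) (v₁ v₂ v₃ : Zpqq p q) (S₀ C : Set (Zpqq p q)) : Prop :=
  -- family 1
  (∃ a b : ℕ → ℤ, a 0 = 0 ∧ b 0 = 0 ∧
    S₀ = {x | ∃ i < p, x = i • v₁ + a i • v₂ + b i • v₃} ∧
    C = {x | ∃ i < q, ∃ j < q, x = i • v₂ + j • v₃}) ∨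
  -- family 2
  (q = 3 ∧ ∃ a : ℕ → ℤ, a 0 = 0 ∧
    S₀ = {x | ∃ i < 3, x = a i • v₁ + a i • v₂ + i • v₃} ∧
    C = {x | ∃ i < p, ∃ j < 3, x = i • v₁ + j • v₂}) ∨
  -- family 3
  (q = 3 ∧ ∃ a c : ℕ → ℤ, a 0 = 0 ∧ c 0 = 0 ∧
    S₀ = {x | ∃ i < 3, ∃ j < p, x = j • v₁ + a i • v₂ + i • v₃} ∧
    C = {x | ∃ i < 3, x = c i • v₁ + i • v₂}) ∨
  -- family 4
  (∃ a c : ℕ → ℤ, a 0 = 0 ∧ c 0 = 0 ∧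
    S₀ = {x | ∃ i < p, ∃ j < q, x = i • v₁ + j • v₂ + a i • v₃} ∧
    C = {x | ∃ i < q, x = c i • v₂ + i • v₃}) ∨
  -- family 5
  (∃ a : ℕ → ℕ → ℤ, a 0 0 = 0 ∧
    S₀ = {x | ∃ i < p, ∃ j < q, x = i • v₁ + a i j • v₂ + j • v₃} ∧
    C = {x | ∃ i < q, x = i • v₂}) ∨
  -- family 6
  (∃ a c : ℕ → ℤ, a 0 = 0 ∧ c 0 = 0 ∧
    S₀ = {x | ∃ i < q, ∃ j < q, x = a i • v₁ + j • v₂ + i • v₃} ∧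
    C = {x | ∃ i < p, x = i • v₁ + c i • v₂}) ∨
  -- family 7
  (∃ a : ℕ → ℕ → ℤ, a 0 0 = 0 ∧
    S₀ = {x | ∃ i < q, ∃ j < q, x = a i j • v₁ + i • v₂ + j • v₃} ∧
    C = {x | ∃ i < p, x = i • v₁})

/-!
A set `C` is a perfect code in `Cay(G, S)` exactly when `G` is tiled by `S₀ = S ∪ {0}` and `C`, that
is, when every element of `G` is a sum of an element of `S₀` and an element of `C` in a unique way
(`isPerfectCode_cayleyDigraph_iff`). Tilings of this form are Mathlib's `AddSubgroup.IsComplement`.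

The main tool is that a factor `A` of a tiling `G = A + B` may be replaced by `k • A` for every
`k ≠ 0` prime to `|A|` (`isComplement_nsmul_image`). For a prime `k` this follows by raising `A` to
the power `k` in the group ring over `ℤ / k`. For `G = ℤ_p × ℤ_q × ℤ_q`, the Chinese remainder
theorem turns this into independent dilations of the factor `ℤ_p` and of the factor
`H = ℤ_q × ℤ_q`: a factor of order `p` may be dilated by `(j, m)` with `j ≠ 0`, and one of order `q`
or `q ^ 2` with `m ≠ 0`. Comparing the resulting tilings produces periods of the complementary
factor, without characters:

* if `|A| = p`, then the `H`-components of the elements of `A` are periods of `B`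
  (`snd_mem_stabilizer`);
* if `|A| = 3 = q` and `A = {0, c, d}`, then the sum of the `H`-components of `c` and `d` is a
  period of `B` (`snd_add_snd_mem_stabilizer`);
* if `|A| = q ≤ 3` and `A` is not contained in `{0} × H`, then `ℤ_p` consists of periods of `B`
  (`mk_zero_mem_stabilizer_of_triple`, `mk_zero_mem_stabilizer_of_fst_ne_zero`).

Since `S` generates `G` and `S₀ ≠ G`, the pair `(|S₀|, |C|)` is `(p, q ^ 2)`, `(q, p * q)`,
`(p * q, q)` or `(q ^ 2, p)`. In each case the periods and a count determine the tiling after an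
automorphism of `H` that moves a distinguished nonzero element to `(1, 0)`; this element becomes
`v₂`. Conversely, in the coordinates given by `v₂` and `v₃` the unique decomposition of an element
is read off from the table (`IsStandardTablePair.isComplement`).
-/

/-! ### Dilating a factor of a tiling -/

section Dilation

open AddSubgroup

variable {G : Type*} [AddCommGroup G] {A B : Set G}

/-- Multiplying the group-ring identity `A * B = G` by `A ^ (l - 1)` and applying the Frobenius
map in characteristic `l`. -/
theorem sum_sum_prime_nsmul_add [Fintype G] (h : IsComplement A B) {l : ℕ} [Fact l.Prime]
    {R : Type*} [CommRing R] [CharP R l] (s : Multiplicative G →* R) [Fintype A] [Fintype B] :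
    ∑ a : A, ∑ b : B, s (.ofAdd (l • (a : G) + b)) =
      (Nat.card A : R) ^ (l - 1) * ∑ g : G, s (.ofAdd g) := by
  have hl : l.Prime := Fact.out
  have hAB : (∑ a : A, s (.ofAdd (a : G))) * ∑ b : B, s (.ofAdd (b : G)) =
      ∑ g : G, s (.ofAdd g) := by
    simp only [Fintype.sum_mul_sum, ← map_mul, ← ofAdd_add]
    rw [← Fintype.sum_prod_type' (f := fun (a : A) (b : B) => s (.ofAdd (a + b : G)))]
    exact Fintype.sum_bijective _ h _ _ fun _ => rfl
  have hg : ∀ a : G, s (.ofAdd a) * ∑ g : G, s (.ofAdd g) = ∑ g : G, s (.ofAdd g) := fun a => by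
    simp only [Finset.mul_sum, ← map_mul, ← ofAdd_add]
    exact Fintype.sum_bijective _ (AddGroup.addLeft_bijective a) _ _ fun _ => rfl
  have hA : (∑ a : A, s (.ofAdd (a : G))) * ∑ g : G, s (.ofAdd g) =
      Nat.card A * ∑ g : G, s (.ofAdd g) := by
    simp only [Finset.sum_mul, hg]
    simp
  have hpow : ∀ n : ℕ, (∑ a : A, s (.ofAdd (a : G))) ^ n * ∑ g : G, s (.ofAdd g) =
      (Nat.card A : R) ^ n * ∑ g : G, s (.ofAdd g) := by
    intro n
    induction n with
    | zero => simp
    | succ n ih => rw [pow_succ, mul_assoc, hA, mul_left_comm, ih]; ring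
  rw [← hpow, ← hAB, ← mul_assoc, ← pow_succ, Nat.sub_add_cancel hl.one_le, sum_pow_char,
    Fintype.sum_mul_sum]
  simp only [ofAdd_add, ofAdd_nsmul, map_mul, map_pow]

/-- If some `g` were not of the form `l • a + b`, comparing the coefficients of `g` in the
group-ring identity over `ℤ / l` would give `|A| ^ (l - 1) = 0`. -/
theorem surjective_prime_nsmul_add [Finite G] (h : IsComplement A B) {l : ℕ} (hl : l.Prime)
    (hA : ¬ l ∣ Nat.card A) : Function.Surjective fun x : A × B => l • (x.1 : G) + x.2 := by
  classical
  have := Fintype.ofFinite G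
  have := Fact.mk hl
  have : CharP (AddMonoidAlgebra (ZMod l) G) l :=
    charP_of_injective_algebraMap (algebraMap (ZMod l) _).injective l
  intro g
  by_contra hg
  push Not at hg
  have key := congrArg (fun f : AddMonoidAlgebra (ZMod l) G => f.coeff g)
    (sum_sum_prime_nsmul_add h (AddMonoidAlgebra.of (ZMod l) G))
  have hne : (Nat.card A : ZMod l) ^ (l - 1) ≠ 0 :=
    pow_ne_zero _ fun h0 => hA ((ZMod.natCast_eq_zero_iff _ _).1 h0)
  have hcast : (Nat.card A : AddMonoidAlgebra (ZMod l) G) ^ (l - 1) =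
      algebraMap (ZMod l) _ ((Nat.card A : ZMod l) ^ (l - 1)) := by
    rw [map_pow, map_natCast]
  rw [hcast, ← Algebra.smul_def] at key
  apply hne
  have h0 : ∀ (a : A) (b : B), l • (a : G) + b ≠ g := fun a b => hg (a, b)
  simpa [AddMonoidAlgebra.coeff_sum, Finsupp.single_apply, h0, eq_comm] using key

/-- In a tiling `A + B = G`, the factor `A` may be replaced by `k • A` for every `k` prime to `|A|`.
For a prime `k` the map `(a, b) ↦ k • a + b` is surjective, hence bijective by counting. -/
theorem isComplement_nsmul_image [Finite G] (h : IsComplement A B) {k : ℕ} (hk : k ≠ 0)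
    (hA : k.Coprime (Nat.card A)) :
    IsComplement ((fun a => k • a) '' A) B ∧ Set.InjOn (fun a => k • a) A := by
  induction k using Nat.recOnMul generalizing A with
  | zero => exact absurd rfl hk
  | one => simpa using h
  | prime l hl =>
    have hs := surjective_prime_nsmul_add h hl ((Nat.Prime.coprime_iff_not_dvd hl).1 hA)
    have hb : Function.Bijective fun x : A × B => l • (x.1 : G) + x.2 := by
      refine (Nat.bijective_iff_surjective_and_card _).2 ⟨hs, ?_⟩
      rw [Nat.card_prod, h.card_mul_card]
    obtain ⟨b, hbB⟩ := h.nonempty_right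
    have hi : Set.InjOn (fun a => l • a) A := fun a ha a' ha' haa' => by
      have := @hb.1 (⟨a, ha⟩, ⟨b, hbB⟩) (⟨a', ha'⟩, ⟨b, hbB⟩) (by simpa using haa')
      simpa using this
    refine ⟨⟨?_, ?_⟩, hi⟩
    · rintro ⟨⟨_, a, ha, rfl⟩, b⟩ ⟨⟨_, a', ha', rfl⟩, b'⟩ hx
      have := @hb.1 (⟨a, ha⟩, b) (⟨a', ha'⟩, b') hx
      simp only [Prod.mk.injEq, Subtype.mk.injEq] at this
      simp [this]
    · intro g
      obtain ⟨⟨a, b⟩, hab⟩ := hb.2 g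
      exact ⟨(⟨_, a, a.2, rfl⟩, b), hab⟩
  | mul m n ihm ihn =>
    obtain ⟨hm, hn⟩ := mul_ne_zero_iff.1 hk
    obtain ⟨cm, cn⟩ := Nat.coprime_mul_iff_left.1 hA
    obtain ⟨h1, i1⟩ := ihn h hn cn
    obtain ⟨h2, i2⟩ := ihm h1 hm (by rwa [Nat.card_image_of_injOn i1])
    constructor
    · simpa only [Set.image_image, mul_smul] using h2
    · simpa only [Function.comp_def, mul_smul] using i2.comp i1 (Set.mapsTo_image _ _)

theorem existsUnique_nsmul [Finite G] (h : IsComplement A B) {k : ℕ} (hk : k ≠ 0)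
    (hA : k.Coprime (Nat.card A)) (g : G) : ∃! a, a ∈ A ∧ g - k • a ∈ B := by
  obtain ⟨h1, h2⟩ := isComplement_nsmul_image h hk hA
  obtain ⟨⟨⟨_, a, ha, rfl⟩, b⟩, hab, hu⟩ := h1.existsUnique g
  refine ⟨a, ⟨ha, ?_⟩, ?_⟩
  · rw [← hab]; simp
  · rintro a' ⟨ha', hb'⟩
    have := hu (⟨_, a', ha', rfl⟩, ⟨_, hb'⟩) (by simp)
    exact h2 ha' ha (congrArg (fun x => (x.1 : G)) this)

end Dilation

/-! ### Dilations of `ℤ_p × ℤ_q × ℤ_q` and the resulting periods -/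

section Periods

open AddSubgroup

variable {p q : ℕ} [Fact p.Prime] [Fact q.Prime]

theorem exists_natCast_eq (hpq : p ≠ q) (j : ZMod p) (m : ZMod q) :
    ∃ k : ℕ, (k : ZMod p) = j ∧ (k : ZMod q) = m := by
  obtain ⟨k, hk1, hk2⟩ := Nat.chineseRemainder
    ((Nat.coprime_primes Fact.out Fact.out).2 hpq) j.val m.val
  refine ⟨k, ?_, ?_⟩
  · rw [(ZMod.natCast_eq_natCast_iff _ _ _).2 hk1, ZMod.natCast_zmod_val]
  · rw [(ZMod.natCast_eq_natCast_iff _ _ _).2 hk2, ZMod.natCast_zmod_val]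

theorem coprime_and_ne_zero {k : ℕ} (hk : (k : ZMod p) ≠ 0) : k ≠ 0 ∧ k.Coprime p := by
  refine ⟨fun h => hk (by simp [h]), ?_⟩
  rw [Nat.coprime_comm, Nat.Prime.coprime_iff_not_dvd Fact.out]
  rwa [Ne, ZMod.natCast_eq_zero_iff] at hk

variable {A B : Set (Zpqq p q)}

theorem nsmul_eq_dilation {k : ℕ} {j : ZMod p} {m : ZMod q} (hj : (k : ZMod p) = j)
    (hm : (k : ZMod q) = m) (a : Zpqq p q) : k • a = (j * a.1, m • a.2) := by
  subst hj hm
  ext <;> simp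

/-- A factor of order `p` may be dilated by any `(j, m)` with `j ≠ 0`, by the Chinese remainder
theorem; `m = 0` is allowed. -/
theorem existsUnique_dilation_of_card_eq_left (h : IsComplement A B) (hpq : p ≠ q)
    (hA : Nat.card A = p) {j : ZMod p} (hj : j ≠ 0) (m : ZMod q) (x : Zpqq p q) :
    ∃! a, a ∈ A ∧ x - (j * a.1, m • a.2) ∈ B := by
  obtain ⟨k, rfl, rfl⟩ := exists_natCast_eq hpq j m
  obtain ⟨h1, h2⟩ := coprime_and_ne_zero hj
  simpa only [nsmul_eq_dilation rfl rfl] using existsUnique_nsmul h h1 (by rwa [hA]) x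

/-- A factor of order a power of `q` may be dilated by any `(j, m)` with `m ≠ 0`; `j = 0` is
allowed. -/
theorem existsUnique_dilation_of_card_eq_right (h : IsComplement A B) (hpq : p ≠ q) {n : ℕ}
    (hA : Nat.card A = q ^ n) (j : ZMod p) {m : ZMod q} (hm : m ≠ 0) (x : Zpqq p q) :
    ∃! a, a ∈ A ∧ x - (j * a.1, m • a.2) ∈ B := by
  obtain ⟨k, rfl, rfl⟩ := exists_natCast_eq hpq j m
  obtain ⟨h1, h2⟩ := coprime_and_ne_zero hm
  simpa only [nsmul_eq_dilation rfl rfl] using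
    existsUnique_nsmul h h1 (hA ▸ Nat.Coprime.pow_right n h2) x

open scoped Classical in
theorem sum_ite_eq_one {α : Type*} {A : Set α} [Fintype A] {P : α → Prop}
    (h : ∃! a, a ∈ A ∧ P a) : ∑ a : A, (if P a then (1 : ℤ) else 0) = 1 := by
  obtain ⟨a, ⟨ha, hP⟩, hu⟩ := h
  rw [Finset.sum_eq_single_of_mem (⟨a, ha⟩ : A) (Finset.mem_univ _) ?_, if_pos hP]
  rintro ⟨b, hb⟩ - hne
  exact if_neg fun hPb => hne (Subtype.ext (hu b ⟨hb, hPb⟩))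

theorem injOn_fst (h : IsComplement A B) (hpq : p ≠ q) (hA : Nat.card A = p) :
    Set.InjOn Prod.fst A := by
  obtain ⟨b, hb⟩ := h.nonempty_right
  intro a ha a' ha' haa'
  refine (existsUnique_dilation_of_card_eq_left h hpq hA one_ne_zero 0 (b + (a.1, 0))).unique
    ⟨ha, ?_⟩ ⟨ha', ?_⟩
  · simpa
  · simpa [haa']

theorem injOn_snd (h : IsComplement A B) (hpq : p ≠ q) {n : ℕ} (hA : Nat.card A = q ^ n) :
    Set.InjOn Prod.snd A := by
  obtain ⟨b, hb⟩ := h.nonempty_right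
  intro a ha a' ha' haa'
  refine (existsUnique_dilation_of_card_eq_right h hpq hA 0 one_ne_zero (b + (0, a.2))).unique
    ⟨ha, ?_⟩ ⟨ha', ?_⟩
  · simpa
  · simpa [haa']

open AddAction Pointwise

theorem mem_stabilizer_of_sub_mem {g : Zpqq p q}
    (h : ∀ x ∈ B, x - g ∈ B) : g ∈ stabilizer (Zpqq p q) B := by
  rw [← neg_mem_iff, mem_stabilizer_set' B.toFinite]
  intro x hx
  simpa [neg_add_eq_sub] using h x hx

/-- If one factor `A` has order `p`, the second component of each of its elements is a period of
the other factor `B`. Let `f` be the indicator function of `B`. The dilation by `(1, 0)` shows that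
`f` has sum `1` on each coset of `ℤ_p`. Summing the counting identities of the dilations by `(j, 1)`
over all `j ≠ 0`, the term of `a = 0` is `(p - 1) * f x`, while that of `a ≠ 0` is
`1 - f (x - (0, a.2))`. The total is `p - 1`, so if `f x = 1` all terms with `a ≠ 0` vanish. -/
theorem snd_mem_stabilizer (h : IsComplement A B) (hpq : p ≠ q) (hA : Nat.card A = p)
    (h0 : 0 ∈ A) {a : Zpqq p q} (ha : a ∈ A) : (0, a.2) ∈ stabilizer (Zpqq p q) B := by
  classical
  have hp : p.Prime := Fact.out
  refine mem_stabilizer_of_sub_mem fun x hx => ?_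
  have zero_def : ((0, 0) : Zpqq p q) = 0 := rfl
  have hb : Function.Bijective fun a : A => (a : Zpqq p q).1 := by
    refine (Nat.bijective_iff_injective_and_card _).2 ⟨?_, by rw [hA, Nat.card_zmod]⟩
    exact fun a a' haa' => Subtype.ext (injOn_fst h hpq hA a.2 a'.2 haa')
  let f : Zpqq p q → ℤ := fun x => if x ∈ B then 1 else 0
  have hf : ∀ x, 0 ≤ f x ∧ f x ≤ 1 := fun x => by by_cases hx : x ∈ B <;> simp [f, hx]
  -- every fibre of the projection to the second factor contains exactly one element of `B`
  have hfib : ∀ x : Zpqq p q, ∑ i : ZMod p, f (x - (i, 0)) = 1 := fun x => by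
    have h1 := sum_ite_eq_one
      (existsUnique_dilation_of_card_eq_left h hpq hA one_ne_zero 0 x)
    simp only [one_mul, zero_smul] at h1
    rw [← h1]
    exact (Fintype.sum_bijective _ hb _ _ fun _ => rfl).symm
  have hterm : ∀ a : A, ∑ j ∈ Finset.univ.erase (0 : ZMod p),
      f (x - (j * (a : Zpqq p q).1, (a : Zpqq p q).2)) =
      if (a : Zpqq p q) = 0 then (p - 1) * f x else 1 - f (x - (0, (a : Zpqq p q).2)) := by
    intro a
    split_ifs with ha0
    · simp [ha0, zero_def, ZMod.card, hp.one_le]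
    · have ha1 : (a : Zpqq p q).1 ≠ 0 := fun h1 =>
        ha0 (injOn_fst h hpq hA a.2 h0 (by simpa using h1))
      rw [eq_sub_iff_add_eq, ← hfib (x - (0, (a : Zpqq p q).2))]
      have : f (x - (0, (a : Zpqq p q).2)) =
        f (x - ((0 : ZMod p) * (a : Zpqq p q).1, (a : Zpqq p q).2)) := by simp
      rw [this, Finset.sum_erase_add _ _ (Finset.mem_univ _)]
      refine Fintype.sum_bijective _ (mulRight_bijective₀ _ ha1) _ _ fun j => ?_
      congr 1
      ext <;> simp
  have htot : ∑ a : A, (if (a : Zpqq p q) = 0 then (p - 1) * f x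
      else 1 - f (x - (0, (a : Zpqq p q).2))) = p - 1 := by
    rw [← Finset.sum_congr rfl fun a _ => hterm a, Finset.sum_comm]
    rw [Finset.sum_congr (g := fun _ => 1) rfl fun j hj => ?_]
    rotate_left
    · have := sum_ite_eq_one (existsUnique_dilation_of_card_eq_left h hpq hA
        (Finset.ne_of_mem_erase hj) 1 x)
      simpa only [one_smul] using this
    · simp [ZMod.card, hp.one_le]
  by_cases ha0 : a = 0
  · simpa [ha0, zero_def] using hx
  by_contra hxa
  have hfx : f x = 1 := if_pos hx
  have hfa : f (x - (0, a.2)) = 0 := if_neg hxa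
  have hne : (⟨0, h0⟩ : A) ≠ ⟨a, ha⟩ := fun h => ha0 (congrArg Subtype.val h).symm
  have hle := Finset.add_le_sum (f := fun a : A => if (a : Zpqq p q) = 0 then (p - 1) * f x
      else 1 - f (x - (0, (a : Zpqq p q).2))) (s := Finset.univ) (fun i _ => by
        have hp1 : (1 : ℤ) ≤ p := by exact_mod_cast hp.one_le
        split_ifs
        · rw [hfx]; linarith
        · linarith [(hf (x - (0, (i : Zpqq p q).2))).2]) (Finset.mem_univ _) (Finset.mem_univ _) hne
  rw [htot] at hle
  simp only [if_pos, ha0, if_false, hfx, hfa] at hle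
  linarith

end Periods

/-! ### Periods forced by factors with two or three elements -/

section SmallFactors

open AddSubgroup AddAction Pointwise

variable {p q : ℕ} [Fact p.Prime] [Fact q.Prime] {A B : Set (Zpqq p q)}

/-- If `x ∈ B`, then `0` is the unique representative of `x` in every dilation of `A` by `(j, 1)`.
When all other elements of `A` have nonzero first coordinate, a representative of `x - (i, 0)` other
than `0` would also represent `x` after a suitable such dilation. -/
theorem mk_zero_mem_stabilizer_of_fst_ne_zero (h : IsComplement A B) (hpq : p ≠ q) {n : ℕ}
    (hA : Nat.card A = q ^ n) (h0 : 0 ∈ A) (h1 : ∀ a ∈ A, a ≠ 0 → a.1 ≠ 0) (i : ZMod p) :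
    (i, 0) ∈ stabilizer (Zpqq p q) B := by
  refine mem_stabilizer_of_sub_mem fun x hx => ?_
  obtain ⟨a, ⟨ha, haB⟩, -⟩ :=
    existsUnique_dilation_of_card_eq_right h hpq hA 1 one_ne_zero (x - (i, 0))
  have ha0 : a = 0 := by
    by_contra hne
    -- the dilation factor that moves `a.1` to `i + a.1`
    have hj : x - (((i + a.1) / a.1) * a.1, (1 : ZMod q) • a.2) ∈ B := by
      rw [div_mul_cancel₀ _ (h1 a ha hne)]
      convert haB using 1
      ext <;> simp [sub_sub]
    exact hne ((existsUnique_dilation_of_card_eq_right h hpq hA ((i + a.1) / a.1) one_ne_zero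
      x).unique ⟨ha, hj⟩ ⟨h0, by simpa [Prod.mk_zero_zero] using hx⟩)
  subst ha0
  convert haB using 1
  ext <;> simp

/-- When `a` is the only element of `A` that moves under the dilations by `(j, 1)`, the translates
of `B` by the dilates of `a` all coincide. -/
theorem mk_zero_mem_stabilizer_of_unique_fst_ne_zero (h : IsComplement A B) (hpq : p ≠ q) {n : ℕ}
    (hA : Nat.card A = q ^ n) {a : Zpqq p q} (ha : a ∈ A) (ha1 : a.1 ≠ 0)
    (h1 : ∀ b ∈ A, b ≠ a → b.1 = 0) (i : ZMod p) :
    (i, 0) ∈ stabilizer (Zpqq p q) B := by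
  refine mem_stabilizer_of_sub_mem fun x hx => ?_
  have hu := existsUnique_dilation_of_card_eq_right h hpq hA 0 one_ne_zero (x + (0, a.2))
  obtain ⟨b, ⟨hb, hbB⟩, -⟩ :=
    existsUnique_dilation_of_card_eq_right h hpq hA (i / a.1) one_ne_zero (x + (0, a.2))
  have hba : b = a := by
    by_contra hne
    refine hne (hu.unique ⟨hb, ?_⟩ ⟨ha, ?_⟩)
    · simpa [h1 b hb hne] using hbB
    · simpa using hx
  subst hba
  rw [div_mul_cancel₀ _ ha1] at hbB
  convert hbB using 1
  ext <;> simp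

theorem iff_not_and_not_of_existsUnique {α : Type*} {a b c : α} {P : α → Prop} (hab : a ≠ b)
    (hac : a ≠ c) (h : ∃! x, x ∈ ({a, b, c} : Set α) ∧ P x) :
    P a ↔ ¬ P b ∧ ¬ P c := by
  constructor
  · intro ha
    exact ⟨fun hb => hab (h.unique ⟨by simp, ha⟩ ⟨by simp, hb⟩),
      fun hc => hac (h.unique ⟨by simp, ha⟩ ⟨by simp, hc⟩)⟩
  · rintro ⟨hb, hc⟩
    obtain ⟨x, ⟨rfl | rfl | rfl, hx⟩, -⟩ := h
    exacts [hx, absurd hx hb, absurd hx hc]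

/-- The sum of the `ℤ_3 × ℤ_3`-components of the two nonzero elements of a three-element factor is
a period of the other factor: in characteristic `3`, suitable translates of the dilations of the
factor by `(0, 1)` and by `(0, -1)` share two of their three points, so that `B` contains both or
neither of the two remaining points. -/
theorem snd_add_snd_mem_stabilizer {A B : Set (Zpqq p 3)} (h : IsComplement A B) (hpq : p ≠ 3)
    {c d : Zpqq p 3} (hA : A = {0, c, d}) (hcd : c ≠ d) (hc : c ≠ 0) (hd : d ≠ 0) :
    (0, c.2 + d.2) ∈ stabilizer (Zpqq p 3) B := by
  have h3 : ∀ y : ZMod 3 × ZMod 3, y + y + y = 0 := by decide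
  have : Fact (Nat.Prime 3) := ⟨Nat.prime_three⟩
  have hcard : Nat.card A = 3 ^ 1 := by
    rw [hA, Nat.card_coe_set_eq, pow_one,
      Set.ncard_eq_three.2 ⟨0, c, d, hc.symm, hd.symm, hcd, rfl⟩]
  rw [mem_stabilizer_set' B.toFinite]
  intro x hx
  have hneg := existsUnique_dilation_of_card_eq_right h hpq hcard 0
    (neg_ne_zero.2 (one_ne_zero (α := ZMod 3))) (x - (0, c.2))
  have hpos := existsUnique_dilation_of_card_eq_right h hpq hcard 0
    (one_ne_zero (α := ZMod 3)) (x - (0, c.2) + (0, d.2))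
  rw [hA] at hneg hpos
  rw [Set.insert_comm] at hneg hpos
  have e1 := iff_not_and_not_of_existsUnique hc hcd hneg
  have e2 := iff_not_and_not_of_existsUnique hc hcd hpos
  simp only [zero_mul, neg_smul, one_smul, Prod.snd_zero, smul_zero, Prod.mk_zero_zero,
    sub_zero] at e1 e2
  have t1 : x - (0, c.2) - (0, -c.2) = x := by ext <;> simp
  have t2 : x - (0, c.2) - (0, -d.2) = x - (0, c.2) + (0, d.2) := by ext <;> simp
  have t3 : x - (0, c.2) + (0, d.2) - (0, d.2) = x - (0, c.2) := by ext <;> simp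
  have t4 : x - (0, c.2) + (0, d.2) - (0, c.2) = (0, c.2 + d.2) + x := by
    refine Prod.ext (by simp) ?_
    change x.2 - c.2 + d.2 - c.2 = c.2 + d.2 + x.2
    rw [← sub_eq_zero, ← neg_eq_zero, ← h3 c.2]
    abel
  rw [t1, t2] at e1
  rw [t3, t4] at e2
  rw [vadd_eq_add]
  tauto

end SmallFactors

/-! ### The table in standard coordinates -/

section Coordinates

variable (p q : ℕ)

/-- The second standard generator of `ℤ_p × ℤ_q × ℤ_q`. -/
def e2 : Zpqq p q := (0, 1, 0)

/-- The third standard generator of `ℤ_p × ℤ_q × ℤ_q`. -/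
def e3 : Zpqq p q := (0, 0, 1)

/-- The table of pairs `(S₀, C)` relative to the standard generators, with the integer parameters
replaced by functions between the coordinate groups. In family 2 the Chinese remainder theorem
makes the two functions independent. -/
def IsStandardTablePair (S₀ C : Set (Zpqq p q)) : Prop :=
  (∃ a b : ZMod p → ZMod q, a 0 = 0 ∧ b 0 = 0 ∧
    S₀ = {x | x.2.1 = a x.1 ∧ x.2.2 = b x.1} ∧ C = {x | x.1 = 0}) ∨
  (q = 3 ∧ ∃ (a : ZMod q → ZMod p) (b : ZMod q → ZMod q), a 0 = 0 ∧ b 0 = 0 ∧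
    S₀ = {x | x.1 = a x.2.2 ∧ x.2.1 = b x.2.2} ∧ C = {x | x.2.2 = 0}) ∨
  (q = 3 ∧ ∃ (a : ZMod q → ZMod q) (c : ZMod q → ZMod p), a 0 = 0 ∧ c 0 = 0 ∧
    S₀ = {x | x.2.1 = a x.2.2} ∧ C = {x | x.1 = c x.2.1 ∧ x.2.2 = 0}) ∨
  (∃ (a : ZMod p → ZMod q) (c : ZMod q → ZMod q), a 0 = 0 ∧ c 0 = 0 ∧
    S₀ = {x | x.2.2 = a x.1} ∧ C = {x | x.1 = 0 ∧ x.2.1 = c x.2.2}) ∨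
  (∃ a : ZMod p → ZMod q → ZMod q, a 0 0 = 0 ∧
    S₀ = {x | x.2.1 = a x.1 x.2.2} ∧ C = {x | x.1 = 0 ∧ x.2.2 = 0}) ∨
  (∃ (a : ZMod q → ZMod p) (c : ZMod p → ZMod q), a 0 = 0 ∧ c 0 = 0 ∧
    S₀ = {x | x.1 = a x.2.2} ∧ C = {x | x.2.1 = c x.1 ∧ x.2.2 = 0}) ∨
  (∃ a : ZMod q → ZMod q → ZMod p, a 0 0 = 0 ∧
    S₀ = {x | x.1 = a x.2.1 x.2.2} ∧ C = {x | x.2.1 = 0 ∧ x.2.2 = 0})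

variable {p q} [Fact p.Prime] [Fact q.Prime]

theorem isTablePair_standard_iff (hpq : p ≠ q) {S₀ C : Set (Zpqq p q)} :
    IsTablePair p q (e1 p q) (e2 p q) (e3 p q) S₀ C ↔ IsStandardTablePair p q S₀ C := by
  have hp := fun (x : ZMod p) => ZMod.val_lt x
  have hq := fun (x : ZMod q) => ZMod.val_lt x
  have hv := fun (i : ℕ) (hi : i < p) => ZMod.val_natCast_of_lt hi
  have hw := fun (i : ℕ) (hi : i < q) => ZMod.val_natCast_of_lt hi
  unfold IsTablePair IsStandardTablePair
  refine or_congr ?_ (or_congr ?_ (or_congr ?_ (or_congr ?_ (or_congr ?_ (or_congr ?_ ?_)))))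
  · have hS : ∀ a b : ℕ → ℤ,
        {x : Zpqq p q | ∃ i < p, x = i • e1 p q + a i • e2 p q + b i • e3 p q} =
          {x : Zpqq p q | x.2.1 = ((a x.1.val : ℤ) : ZMod q) ∧
            x.2.2 = ((b x.1.val : ℤ) : ZMod q)} := by
      intro a b
      ext ⟨x, y, z⟩
      constructor
      · rintro ⟨i, hi, h⟩
        simp [e1, e2, e3] at h
        obtain ⟨rfl, rfl, rfl⟩ := h
        simp [hv i hi]
      · intro h
        exact ⟨x.val, hp _, by simp_all [e1, e2, e3]⟩
    have hC :
        {x : Zpqq p q | ∃ i < q, ∃ j < q, x = i • e2 p q + j • e3 p q} =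
          {x : Zpqq p q | x.1 = 0} := by
      ext ⟨x, y, z⟩
      constructor
      · rintro ⟨i, hi, j, hj, h⟩
        simp [e2, e3] at h
        obtain ⟨rfl, rfl, rfl⟩ := h
        simp
      · intro h
        exact ⟨y.val, hq _, z.val, hq _, by simp_all [e1, e2, e3]⟩
    simp only [hS, hC]
    constructor
    · rintro ⟨a, b, ha, hb, h⟩
      exact ⟨fun x => a x.val, fun x => b x.val, by simp [ha], by simp [hb], h⟩
    · rintro ⟨a, b, ha, hb, h⟩
      exact ⟨fun i => (a i).val, fun i => (b i).val, by simp [ha], by simp [hb], by simpa using h⟩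
  · refine and_congr_right fun h3 => ?_
    rw [← h3]
    have hS : ∀ a : ℕ → ℤ,
        {x : Zpqq p q | ∃ i < q, x = a i • e1 p q + a i • e2 p q + i • e3 p q} =
          {x : Zpqq p q | x.1 = ((a x.2.2.val : ℤ) : ZMod p) ∧
            x.2.1 = ((a x.2.2.val : ℤ) : ZMod q)} := by
      intro a
      ext ⟨x, y, z⟩
      constructor
      · rintro ⟨i, hi, h⟩
        simp [e1, e2, e3] at h
        obtain ⟨rfl, rfl, rfl⟩ := h
        simp [hw i hi]
      · intro h
        exact ⟨z.val, hq _, by simp_all [e1, e2, e3]⟩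
    have hC :
        {x : Zpqq p q | ∃ i < p, ∃ j < q, x = i • e1 p q + j • e2 p q} =
          {x : Zpqq p q | x.2.2 = 0} := by
      ext ⟨x, y, z⟩
      constructor
      · rintro ⟨i, hi, j, hj, h⟩
        simp [e1, e2] at h
        obtain ⟨rfl, rfl, rfl⟩ := h
        simp
      · intro h
        exact ⟨x.val, hp _, y.val, hq _, by simp_all [e1, e2, e3]⟩
    simp only [hS, hC]
    constructor
    · rintro ⟨a, ha, h⟩
      exact ⟨fun x => a x.val, fun x => a x.val, by simp [ha], by simp [ha], h⟩
    · rintro ⟨a, b, ha, hb, h⟩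
      -- one integer serves as coefficient of both `v₁` and `v₂`
      have hcrt : ∀ i : ℕ, ∃ k : ℤ, (i = 0 → k = 0) ∧ (k : ZMod p) = a i ∧ (k : ZMod q) = b i := by
        intro i
        obtain rfl | hi := eq_or_ne i 0
        · exact ⟨0, by simp [ha, hb]⟩
        obtain ⟨k, hk1, hk2⟩ := exists_natCast_eq hpq (a i) (b i)
        exact ⟨k, by simp [hi], by simpa using hk1, by simpa using hk2⟩
      choose k hk0 hk1 hk2 using hcrt
      exact ⟨k, hk0 0 rfl, by simpa [hk1, hk2] using h⟩
  · refine and_congr_right fun h3 => ?_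
    rw [← h3]
    have hS : ∀ a : ℕ → ℤ,
        {x : Zpqq p q | ∃ i < q, ∃ j < p, x = j • e1 p q + a i • e2 p q + i • e3 p q} =
          {x : Zpqq p q | x.2.1 = ((a x.2.2.val : ℤ) : ZMod q)} := by
      intro a
      ext ⟨x, y, z⟩
      constructor
      · rintro ⟨i, hi, j, hj, h⟩
        simp [e1, e2, e3] at h
        obtain ⟨rfl, rfl, rfl⟩ := h
        simp [hw i hi]
      · intro h
        exact ⟨z.val, hq _, x.val, hp _, by simp_all [e1, e2, e3]⟩
    have hC : ∀ c : ℕ → ℤ,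
        {x : Zpqq p q | ∃ i < q, x = c i • e1 p q + i • e2 p q} =
          {x : Zpqq p q | x.1 = ((c x.2.1.val : ℤ) : ZMod p) ∧ x.2.2 = 0} := by
      intro c
      ext ⟨x, y, z⟩
      constructor
      · rintro ⟨i, hi, h⟩
        simp [e1, e2] at h
        obtain ⟨rfl, rfl, rfl⟩ := h
        simp [hw i hi]
      · intro h
        exact ⟨y.val, hq _, by simp_all [e1, e2, e3]⟩
    simp only [hS, hC]
    constructor
    · rintro ⟨a, c, ha, hc, h⟩
      exact ⟨fun x => a x.val, fun x => c x.val, by simp [ha], by simp [hc], h⟩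
    · rintro ⟨a, c, ha, hc, h⟩
      exact ⟨fun i => (a i).val, fun i => (c i).val, by simp [ha], by simp [hc], by simpa using h⟩
  · have hS : ∀ a : ℕ → ℤ,
        {x : Zpqq p q | ∃ i < p, ∃ j < q, x = i • e1 p q + j • e2 p q + a i • e3 p q} =
          {x : Zpqq p q | x.2.2 = ((a x.1.val : ℤ) : ZMod q)} := by
      intro a
      ext ⟨x, y, z⟩
      constructor
      · rintro ⟨i, hi, j, hj, h⟩
        simp [e1, e2, e3] at h
        obtain ⟨rfl, rfl, rfl⟩ := h
        simp [hv i hi]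
      · intro h
        exact ⟨x.val, hp _, y.val, hq _, by simp_all [e1, e2, e3]⟩
    have hC : ∀ c : ℕ → ℤ,
        {x : Zpqq p q | ∃ i < q, x = c i • e2 p q + i • e3 p q} =
          {x : Zpqq p q | x.1 = 0 ∧ x.2.1 = ((c x.2.2.val : ℤ) : ZMod q)} := by
      intro c
      ext ⟨x, y, z⟩
      constructor
      · rintro ⟨i, hi, h⟩
        simp [e2, e3] at h
        obtain ⟨rfl, rfl, rfl⟩ := h
        simp [hw i hi]
      · intro h
        exact ⟨z.val, hq _, by simp_all [e1, e2, e3]⟩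
    simp only [hS, hC]
    constructor
    · rintro ⟨a, c, ha, hc, h⟩
      exact ⟨fun x => a x.val, fun x => c x.val, by simp [ha], by simp [hc], h⟩
    · rintro ⟨a, c, ha, hc, h⟩
      exact ⟨fun i => (a i).val, fun i => (c i).val, by simp [ha], by simp [hc], by simpa using h⟩
  · have hS : ∀ a : ℕ → ℕ → ℤ,
        {x : Zpqq p q | ∃ i < p, ∃ j < q, x = i • e1 p q + a i j • e2 p q + j • e3 p q} =
          {x : Zpqq p q | x.2.1 = ((a x.1.val x.2.2.val : ℤ) : ZMod q)} := by
      intro a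
      ext ⟨x, y, z⟩
      constructor
      · rintro ⟨i, hi, j, hj, h⟩
        simp [e1, e2, e3] at h
        obtain ⟨rfl, rfl, rfl⟩ := h
        simp [hv i hi, hw j hj]
      · intro h
        exact ⟨x.val, hp _, z.val, hq _, by simp_all [e1, e2, e3]⟩
    have hC :
        {x : Zpqq p q | ∃ i < q, x = i • e2 p q} =
          {x : Zpqq p q | x.1 = 0 ∧ x.2.2 = 0} := by
      ext ⟨x, y, z⟩
      constructor
      · rintro ⟨i, hi, h⟩
        simp [e2] at h
        obtain ⟨rfl, rfl, rfl⟩ := h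
        simp
      · intro h
        exact ⟨y.val, hq _, by simp_all [e1, e2, e3]⟩
    simp only [hS, hC]
    constructor
    · rintro ⟨a, ha, h⟩
      exact ⟨fun x y => a x.val y.val, by simp [ha], h⟩
    · rintro ⟨a, ha, h⟩
      exact ⟨fun i j => (a i j).val, by simp [ha], by simpa using h⟩
  · have hS : ∀ a : ℕ → ℤ,
        {x : Zpqq p q | ∃ i < q, ∃ j < q, x = a i • e1 p q + j • e2 p q + i • e3 p q} =
          {x : Zpqq p q | x.1 = ((a x.2.2.val : ℤ) : ZMod p)} := by
      intro a
      ext ⟨x, y, z⟩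
      constructor
      · rintro ⟨i, hi, j, hj, h⟩
        simp [e1, e2, e3] at h
        obtain ⟨rfl, rfl, rfl⟩ := h
        simp [hw i hi]
      · intro h
        exact ⟨z.val, hq _, y.val, hq _, by simp_all [e1, e2, e3]⟩
    have hC : ∀ c : ℕ → ℤ,
        {x : Zpqq p q | ∃ i < p, x = i • e1 p q + c i • e2 p q} =
          {x : Zpqq p q | x.2.1 = ((c x.1.val : ℤ) : ZMod q) ∧ x.2.2 = 0} := by
      intro c
      ext ⟨x, y, z⟩
      constructor
      · rintro ⟨i, hi, h⟩
        simp [e1, e2] at h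
        obtain ⟨rfl, rfl, rfl⟩ := h
        simp [hv i hi]
      · intro h
        exact ⟨x.val, hp _, by simp_all [e1, e2, e3]⟩
    simp only [hS, hC]
    constructor
    · rintro ⟨a, c, ha, hc, h⟩
      exact ⟨fun x => a x.val, fun x => c x.val, by simp [ha], by simp [hc], h⟩
    · rintro ⟨a, c, ha, hc, h⟩
      exact ⟨fun i => (a i).val, fun i => (c i).val, by simp [ha], by simp [hc], by simpa using h⟩
  · have hS : ∀ a : ℕ → ℕ → ℤ,
        {x : Zpqq p q | ∃ i < q, ∃ j < q, x = a i j • e1 p q + i • e2 p q + j • e3 p q} =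
          {x : Zpqq p q | x.1 = ((a x.2.1.val x.2.2.val : ℤ) : ZMod p)} := by
      intro a
      ext ⟨x, y, z⟩
      constructor
      · rintro ⟨i, hi, j, hj, h⟩
        simp [e1, e2, e3] at h
        obtain ⟨rfl, rfl, rfl⟩ := h
        simp [hw i hi, hw j hj]
      · intro h
        exact ⟨y.val, hq _, z.val, hq _, by simp_all [e1, e2, e3]⟩
    have hC :
        {x : Zpqq p q | ∃ i < p, x = i • e1 p q} =
          {x : Zpqq p q | x.2.1 = 0 ∧ x.2.2 = 0} := by
      ext ⟨x, y, z⟩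
      constructor
      · rintro ⟨i, hi, h⟩
        simp [e1] at h
        obtain ⟨rfl, rfl, rfl⟩ := h
        simp
      · intro h
        exact ⟨x.val, hp _, by simp_all [e1, e2, e3]⟩
    simp only [hS, hC]
    constructor
    · rintro ⟨a, ha, h⟩
      exact ⟨fun x y => a x.val y.val, by simp [ha], h⟩
    · rintro ⟨a, ha, h⟩
      exact ⟨fun i j => (a i j).val, by simp [ha], by simpa using h⟩

end Coordinates

/-! ### Change of generators of `{0} × ℤ_q × ℤ_q` -/

section Transport

open AddSubgroup

theorem isComplement_image {G K : Type*} [AddGroup G] [AddGroup K] (L : G ≃+ K) {A B : Set G}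
    (h : IsComplement A B) : IsComplement (L '' A) (L '' B) := by
  constructor
  · rintro ⟨⟨_, a, ha, rfl⟩, ⟨_, b, hb, rfl⟩⟩ ⟨⟨_, a', ha', rfl⟩, ⟨_, b', hb', rfl⟩⟩ hx
    have := @h.1 (⟨a, ha⟩, ⟨b, hb⟩) (⟨a', ha'⟩, ⟨b', hb'⟩) (L.injective (by simpa using hx))
    simp only [Prod.mk.injEq, Subtype.mk.injEq] at this
    simp [this]
  · intro g
    obtain ⟨⟨a, b⟩, hab⟩ := h.2 (L.symm g)
    refine ⟨(⟨_, a, a.2, rfl⟩, ⟨_, b, b.2, rfl⟩), ?_⟩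
    simp only at hab ⊢
    rw [← map_add, hab, L.apply_symm_apply]

variable {p q : ℕ}

theorem IsTablePair.image (L : Zpqq p q ≃+ Zpqq p q) {v₁ v₂ v₃ : Zpqq p q} {S₀ C : Set (Zpqq p q)}
    (h : IsTablePair p q v₁ v₂ v₃ S₀ C) :
    IsTablePair p q (L v₁) (L v₂) (L v₃) (L '' S₀) (L '' C) := by
  have himg : ∀ P : Zpqq p q → Prop, L '' {x | P x} = {x | P (L.symm x)} := fun P =>
    L.toEquiv.image_eq_preimage_symm _
  unfold IsTablePair at h ⊢
  refine Or.imp ?_ (Or.imp ?_ (Or.imp ?_ (Or.imp ?_ (Or.imp ?_ (Or.imp ?_ ?_))))) h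
  · rintro ⟨a, b, ha, hb, rfl, rfl⟩
    exact ⟨a, b, ha, hb, by simp only [himg, L.symm_apply_eq, map_add, map_nsmul, map_zsmul],
      by simp only [himg, L.symm_apply_eq, map_add, map_nsmul]⟩
  · rintro ⟨h3, a, ha, rfl, rfl⟩
    exact ⟨h3, a, ha, by simp only [himg, L.symm_apply_eq, map_add, map_nsmul, map_zsmul],
      by simp only [himg, L.symm_apply_eq, map_add, map_nsmul]⟩
  · rintro ⟨h3, a, c, ha, hc, rfl, rfl⟩
    exact ⟨h3, a, c, ha, hc, by simp only [himg, L.symm_apply_eq, map_add, map_nsmul, map_zsmul],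
      by simp only [himg, L.symm_apply_eq, map_add, map_nsmul, map_zsmul]⟩
  · rintro ⟨a, c, ha, hc, rfl, rfl⟩
    exact ⟨a, c, ha, hc, by simp only [himg, L.symm_apply_eq, map_add, map_nsmul, map_zsmul],
      by simp only [himg, L.symm_apply_eq, map_add, map_nsmul, map_zsmul]⟩
  · rintro ⟨a, ha, rfl, rfl⟩
    exact ⟨a, ha, by simp only [himg, L.symm_apply_eq, map_add, map_nsmul, map_zsmul],
      by simp only [himg, L.symm_apply_eq, map_nsmul]⟩
  · rintro ⟨a, c, ha, hc, rfl, rfl⟩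
    exact ⟨a, c, ha, hc, by simp only [himg, L.symm_apply_eq, map_add, map_nsmul, map_zsmul],
      by simp only [himg, L.symm_apply_eq, map_add, map_nsmul, map_zsmul]⟩
  · rintro ⟨a, ha, rfl, rfl⟩
    exact ⟨a, ha, by simp only [himg, L.symm_apply_eq, map_add, map_nsmul, map_zsmul],
      by simp only [himg, L.symm_apply_eq, map_nsmul]⟩

/-- The automorphism of `ℤ_p × ℤ_q × ℤ_q` that fixes the first factor and acts as `M` on the
other two. -/
def sndEquiv (M : (ZMod q × ZMod q) ≃+ (ZMod q × ZMod q)) : Zpqq p q ≃+ Zpqq p q :=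
  (AddEquiv.refl (ZMod p)).prodCongr M

@[simp]
theorem sndEquiv_apply (M : (ZMod q × ZMod q) ≃+ (ZMod q × ZMod q)) (x : Zpqq p q) :
    sndEquiv M x = (x.1, M x.2) := rfl

@[simp]
theorem sndEquiv_e1 (M : (ZMod q × ZMod q) ≃+ (ZMod q × ZMod q)) :
    sndEquiv M (e1 p q) = e1 p q :=
  Prod.ext rfl (map_zero M)

theorem IsGeneratingPair.sndEquiv (M : (ZMod q × ZMod q) ≃+ (ZMod q × ZMod q)) {v₂ v₃ : Zpqq p q}
    (h : IsGeneratingPair v₂ v₃) : IsGeneratingPair (sndEquiv M v₂) (sndEquiv M v₃) := by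
  unfold IsGeneratingPair at h ⊢
  rw [← Set.image_pair, ← AddEquiv.coe_toAddMonoidHom, ← AddMonoidHom.map_closure, h]
  ext ⟨x, y⟩
  simp only [AddSubgroup.mem_map, AddSubgroup.mem_prod]
  constructor
  · rintro ⟨⟨a, b⟩, h, hab⟩
    simp_all [Prod.ext_iff]
  · rintro ⟨h, -⟩
    exact ⟨(x, M.symm y), by simpa using h, by simp⟩

variable [Fact p.Prime] [Fact q.Prime]

theorem isGeneratingPair_standard : IsGeneratingPair (e2 p q) (e3 p q) := by
  unfold IsGeneratingPair
  apply le_antisymm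
  · rw [closure_le]
    rintro _ (rfl | rfl) <;> simp [e2, e3, AddSubgroup.mem_prod]
  · rintro ⟨x, y, z⟩ ⟨hx, -⟩
    obtain rfl : x = 0 := by simpa using hx
    have : ((0, y, z) : Zpqq p q) = y.val • e2 p q + z.val • e3 p q := by simp [e2, e3]
    rw [this]
    exact add_mem (nsmul_mem (subset_closure (by simp)) _) (nsmul_mem (subset_closure (by simp)) _)

theorem exists_sndEquiv_of_isGeneratingPair {v₂ v₃ : Zpqq p q} (h : IsGeneratingPair v₂ v₃) :
    ∃ M : (ZMod q × ZMod q) ≃+ (ZMod q × ZMod q),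
      sndEquiv M (e2 p q) = v₂ ∧ sndEquiv M (e3 p q) = v₃ := by
  unfold IsGeneratingPair at h
  have h2 : v₂ ∈ (⊥ : AddSubgroup (ZMod p)).prod (⊤ : AddSubgroup (ZMod q × ZMod q)) :=
    h ▸ subset_closure (by simp)
  have h3 : v₃ ∈ (⊥ : AddSubgroup (ZMod p)).prod (⊤ : AddSubgroup (ZMod q × ZMod q)) :=
    h ▸ subset_closure (by simp)
  obtain ⟨x, w₂⟩ := v₂
  obtain ⟨x', w₃⟩ := v₃
  obtain rfl : x = 0 := by simpa using h2.1
  obtain rfl : x' = 0 := by simpa using h3.1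
  let f : (ZMod q × ZMod q) →+ (ZMod q × ZMod q) :=
    { toFun := fun x => x.1 • w₂ + x.2 • w₃
      map_zero' := by simp
      map_add' := fun x y => by simp only [Prod.fst_add, Prod.snd_add, add_smul]; abel }
  have hf : Function.Surjective f := by
    intro y
    have hy : ((0, y) : Zpqq p q) ∈ AddSubgroup.closure {((0, w₂) : Zpqq p q), (0, w₃)} := by
      rw [h]; exact ⟨by simp, by simp⟩
    obtain ⟨m, n, hmn⟩ := AddSubgroup.mem_closure_pair.1 hy
    refine ⟨(m, n), ?_⟩
    simpa [f, Int.cast_smul_eq_zsmul] using congrArg Prod.snd hmn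
  exact ⟨AddEquiv.ofBijective f (Finite.injective_iff_surjective.2 hf |>.bijective_of_finite),
    by simp [e2, f], by simp [e3, f]⟩

theorem exists_addEquiv_apply_eq {w : ZMod q × ZMod q} (hw : w ≠ 0) :
    ∃ M : (ZMod q × ZMod q) ≃+ (ZMod q × ZMod q), M w = (1, 0) := by
  obtain ⟨a, b⟩ := w
  by_cases ha : a = 0
  · subst ha
    have hb : b ≠ 0 := by rintro rfl; exact hw rfl
    exact ⟨{ toFun := fun x => (b⁻¹ * x.2, x.1)
             invFun := fun x => (x.2, b * x.1)
             left_inv := fun x => by simp [hb]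
             right_inv := fun x => by simp [hb]
             map_add' := fun x y => by simp [mul_add] }, by simp [hb]⟩
  · exact ⟨{ toFun := fun x => (a⁻¹ * x.1, x.2 - b * (a⁻¹ * x.1))
             invFun := fun x => (a * x.1, x.2 + b * x.1)
             left_inv := fun x => by simp [ha]
             right_inv := fun x => by simp [ha]
             map_add' := fun x y => by simp [mul_add]; ring }, by simp [ha]⟩

/-- `(S₀, C)` is in the table with respect to some pair of generators of `{0} × ℤ_q × ℤ_q`. -/
def IsInTable (S₀ C : Set (Zpqq p q)) : Prop :=
  ∃ v₂ v₃ : Zpqq p q, IsGeneratingPair v₂ v₃ ∧ IsTablePair p q (e1 p q) v₂ v₃ S₀ C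

theorem IsStandardTablePair.isInTable (hpq : p ≠ q) {S₀ C : Set (Zpqq p q)}
    (h : IsStandardTablePair p q S₀ C) : IsInTable S₀ C :=
  ⟨_, _, isGeneratingPair_standard, (isTablePair_standard_iff hpq).2 h⟩

omit [Fact p.Prime] in
theorem IsInTable.of_image {M : (ZMod q × ZMod q) ≃+ (ZMod q × ZMod q)} {S₀ C : Set (Zpqq p q)}
    (h : IsInTable (sndEquiv M '' S₀) (sndEquiv M '' C)) : IsInTable S₀ C := by
  obtain ⟨v₂, v₃, hv, ht⟩ := h
  have h0 : (sndEquiv M).symm (e1 p q) = e1 p q := by rw [AddEquiv.symm_apply_eq, sndEquiv_e1]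
  have h1 := ht.image (sndEquiv M).symm
  rw [Set.image_image, Set.image_image, h0] at h1
  simp only [AddEquiv.symm_apply_apply, Set.image_id'] at h1
  exact ⟨_, _, hv.sndEquiv M.symm, h1⟩

theorem isComplement_of_forall_mem {S C : Set (Zpqq p q)} (f : Zpqq p q → Zpqq p q)
    (hf : ∀ g, f g ∈ C ∧ g - f g ∈ S) (hu : ∀ g, ∀ u ∈ C, g - u ∈ S → u = f g) :
    IsComplement S C := by
  rw [isComplement_iff_existsUnique_add_neg_mem]
  intro g
  refine ⟨⟨f g, (hf g).1⟩, by simpa [sub_eq_add_neg] using (hf g).2, ?_⟩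
  rintro ⟨u, hu'⟩ h
  exact Subtype.ext (hu g u hu' (by simpa [sub_eq_add_neg] using h))

theorem IsStandardTablePair.isComplement {S₀ C : Set (Zpqq p q)}
    (h : IsStandardTablePair p q S₀ C) : IsComplement S₀ C := by
  rcases h with ⟨a, b, ha, hb, rfl, rfl⟩ | ⟨-, a, b, ha, hb, rfl, rfl⟩ |
    ⟨-, a, c, ha, hc, rfl, rfl⟩ | ⟨a, c, ha, hc, rfl, rfl⟩ | ⟨a, ha, rfl, rfl⟩ |
    ⟨a, c, ha, hc, rfl, rfl⟩ | ⟨a, ha, rfl, rfl⟩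
  · refine isComplement_of_forall_mem (fun g => (0, g.2.1 - a g.1, g.2.2 - b g.1))
      (fun g => by simp) ?_
    rintro ⟨x, y, z⟩ ⟨u, v, w⟩ hC hS
    simp_all
    simp [← hS.1, ← hS.2]
  · refine isComplement_of_forall_mem (fun g => (g.1 - a g.2.2, g.2.1 - b g.2.2, 0))
      (fun g => by simp) ?_
    rintro ⟨x, y, z⟩ ⟨u, v, w⟩ hC hS
    simp_all
    simp [← hS.1, ← hS.2]
  · refine isComplement_of_forall_mem
      (fun g => (c (g.2.1 - a g.2.2), g.2.1 - a g.2.2, 0)) (fun g => by simp) ?_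
    rintro ⟨x, y, z⟩ ⟨u, v, w⟩ hC hS
    simp_all
    simp [← hS]
  · refine isComplement_of_forall_mem (fun g => (0, c (g.2.2 - a g.1), g.2.2 - a g.1))
      (fun g => by simp) ?_
    rintro ⟨x, y, z⟩ ⟨u, v, w⟩ hC hS
    simp_all
    simp [← hS]
  · refine isComplement_of_forall_mem (fun g => (0, g.2.1 - a g.1 g.2.2, 0)) (fun g => by simp) ?_
    rintro ⟨x, y, z⟩ ⟨u, v, w⟩ hC hS
    simp_all
    simp [← hS]
  · refine isComplement_of_forall_mem (fun g => (g.1 - a g.2.2, c (g.1 - a g.2.2), 0))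
      (fun g => by simp) ?_
    rintro ⟨x, y, z⟩ ⟨u, v, w⟩ hC hS
    simp_all
    simp [← hS]
  · refine isComplement_of_forall_mem (fun g => (g.1 - a g.2.1 g.2.2, 0, 0)) (fun g => by simp) ?_
    rintro ⟨x, y, z⟩ ⟨u, v, w⟩ hC hS
    simp_all
    simp [← hS]

theorem IsInTable.isComplement (hpq : p ≠ q) {S₀ C : Set (Zpqq p q)}
    (h : IsInTable S₀ C) : IsComplement S₀ C := by
  obtain ⟨v₂, v₃, hv, ht⟩ := h
  obtain ⟨M, rfl, rfl⟩ := exists_sndEquiv_of_isGeneratingPair hv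
  have h1 := ht.image (sndEquiv M).symm
  have h0 : (sndEquiv M).symm (e1 p q) = e1 p q := by rw [AddEquiv.symm_apply_eq, sndEquiv_e1]
  simp only [h0, AddEquiv.symm_apply_apply] at h1
  have h2 := isComplement_image (sndEquiv M)
    ((isTablePair_standard_iff hpq).1 (by simpa using h1)).isComplement
  rw [Set.image_image, Set.image_image] at h2
  simpa using h2

end Transport

/-! ### Recognizing the seven families in standard coordinates -/

section StandardFamilies

open AddSubgroup AddAction Pointwise

/-- A set on which `f` restricts to a bijection onto `K` is the image of a section of `f`. -/
theorem exists_section {α K : Type*} [Finite α] [Finite K] {A : Set α} {f : α → K}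
    (hf : Set.InjOn f A) (hcard : Nat.card A = Nat.card K) :
    ∃ g : K → α, (∀ k, f (g k) = k) ∧ ∀ x, x ∈ A ↔ g (f x) = x := by
  have hb : Function.Bijective fun a : A => f a :=
    (Nat.bijective_iff_injective_and_card _).2
      ⟨fun a b hab => Subtype.ext (hf a.2 b.2 hab), hcard⟩
  choose g hg using hb.2
  refine ⟨fun k => g k, hg, fun x => ⟨fun hx => ?_, fun hx => hx ▸ (g (f x)).2⟩⟩
  exact hf (g (f x)).2 hx (hg (f x))

section General

variable {G : Type*} [AddCommGroup G] {S C : Set G}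

theorem isComplement_symm (h : IsComplement S C) : IsComplement C S := by
  have : (fun x : C × S => (x.1 : G) + x.2) = (fun x : S × C => (x.1 : G) + x.2) ∘ Prod.swap := by
    ext x
    exact add_comm _ _
  unfold IsComplement
  rw [this]
  exact h.comp Prod.swap_bijective

theorem eq_and_eq_of_isComplement (h : IsComplement S C) {s s' c c' : G} (hs : s ∈ S) (hs' : s' ∈ S)
    (hc : c ∈ C) (hc' : c' ∈ C) (heq : s + c = s' + c') : s = s' ∧ c = c' := by
  have := @h.1 (⟨s, hs⟩, ⟨c, hc⟩) (⟨s', hs'⟩, ⟨c', hc'⟩) heq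
  simpa using this

theorem exists_add_eq_of_isComplement (h : IsComplement S C) (g : G) :
    ∃ s ∈ S, ∃ c ∈ C, s + c = g := by
  obtain ⟨⟨s, c⟩, hsc⟩ := h.2 g
  exact ⟨s, s.2, c, c.2, hsc⟩

/-- A factor containing the kernel of `f`, with a complement of the order of the target of `f`, is
equal to that kernel, and its complement is the image of a section of `f`. -/
theorem exists_section_of_ker_subset [Finite G] {K : Type*} [AddCommGroup K] [Finite K]
    (f : G →+ K) (h : IsComplement S C) (h0 : 0 ∈ S) (hker : ∀ x, f x = 0 → x ∈ C)
    (hcard : Nat.card S = Nat.card K) :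
    (∃ g : K → G, (∀ k, f (g k) = k) ∧ ∀ x, x ∈ S ↔ g (f x) = x) ∧ C = {x | f x = 0} := by
  obtain ⟨g, hg, hS⟩ := exists_section (A := S) (f := f) (fun s hs s' hs' hss' =>
    (eq_and_eq_of_isComplement h hs hs' (hker 0 (map_zero f)) (hker (s - s') (by simp [hss']))
      (by abel)).1) hcard
  refine ⟨⟨g, hg, hS⟩, Set.Subset.antisymm (fun c hc => ?_) hker⟩
  have hgS : g (f c) ∈ S := (hS _).2 (by rw [hg])
  have := (eq_and_eq_of_isComplement h hgS h0 (hker (c - g (f c)) (by simp [hg])) hc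
    (by abel)).1
  rw [Set.mem_ofPred_eq, ← hg (f c), this, map_zero]

end General

variable {p q : ℕ} [Fact p.Prime] [Fact q.Prime] {S C : Set (Zpqq p q)}

theorem mk_mem_stabilizer_of_e2_mem (h : e2 p q ∈ stabilizer (Zpqq p q) S) (y : ZMod q) :
    (0, y, 0) ∈ stabilizer (Zpqq p q) S := by
  have : (0, y, 0) = y.val • e2 p q := by simp [e2]
  rw [this]
  exact nsmul_mem h _

theorem add_mem_iff {g : Zpqq p q} (h : g ∈ stabilizer (Zpqq p q) S) (x : Zpqq p q) :
    g + x ∈ S ↔ x ∈ S := by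
  simpa using mem_stabilizer_set.1 h x

/-- Family 1: `S` has order `p` and `C` contains `{0} × ℤ_q × ℤ_q`. -/
theorem isStandardTablePair_of_ker_fst_subset (h : IsComplement S C) (h0 : 0 ∈ S)
    (hS : Nat.card S = p) (hC : ∀ x : Zpqq p q, x.1 = 0 → x ∈ C) :
    IsStandardTablePair p q S C := by
  obtain ⟨⟨g, hg, hgS⟩, rfl⟩ := exists_section_of_ker_subset
    (AddMonoidHom.fst (ZMod p) (ZMod q × ZMod q)) h h0 hC (by simp [hS])
  simp only [AddMonoidHom.coe_fst] at hg hgS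
  have hg0 : g 0 = 0 := (hgS 0).1 h0
  refine Or.inl ⟨fun i => (g i).2.1, fun i => (g i).2.2, by simp [hg0], by simp [hg0], ?_, rfl⟩
  ext x
  rw [hgS, Prod.ext_iff, Prod.ext_iff]
  simp [hg, eq_comm]

/-- Family 2: `S` has order `q = 3` and `C` contains `ℤ_p × ℤ_q × {0}`. -/
theorem isStandardTablePair_of_ker_last_subset (h3 : q = 3) (h : IsComplement S C) (h0 : 0 ∈ S)
    (hS : Nat.card S = q) (hC : ∀ x : Zpqq p q, x.2.2 = 0 → x ∈ C) :
    IsStandardTablePair p q S C := by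
  obtain ⟨⟨g, hg, hgS⟩, rfl⟩ := exists_section_of_ker_subset
    ((AddMonoidHom.snd (ZMod q) (ZMod q)).comp (AddMonoidHom.snd (ZMod p) (ZMod q × ZMod q)))
    h h0 hC (by simp [hS])
  simp only [AddMonoidHom.coe_comp, AddMonoidHom.coe_snd, Function.comp_apply] at hg hgS
  have hg0 : g 0 = 0 := (hgS 0).1 h0
  refine Or.inr (Or.inl ⟨h3, fun i => (g i).1, fun i => (g i).2.1, by simp [hg0], by simp [hg0],
    ?_, rfl⟩)
  ext x
  rw [hgS, Prod.ext_iff, Prod.ext_iff]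
  simp [hg, eq_comm]

/-- Family 3: `S` is `ℤ_p`-periodic, so the first coordinates of the elements of `C` are
irrelevant to the tiling. -/
theorem isStandardTablePair_of_fst_periodic (h3 : q = 3) (h : IsComplement S C) (h0S : 0 ∈ S)
    (h0C : 0 ∈ C) (hS : ∀ i : ZMod p, (i, 0) ∈ stabilizer (Zpqq p q) S)
    (hC : Nat.card C = q) (hz : ∀ x ∈ C, x.2.2 = 0)
    (hinj : Set.InjOn (fun x : Zpqq p q => x.2.1) C) : IsStandardTablePair p q S C := by
  obtain ⟨g, hg, hgC⟩ := exists_section hinj (by simp [hC])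
  have hg0 : g 0 = 0 := (hgC 0).1 h0C
  have hmem : ∀ x x' h, (x, h) ∈ S → (x', h) ∈ S := fun x x' h hx => by
    simpa using (add_mem_iff (hS (x' - x)) _).2 hx
  have hgmem : ∀ k, g k ∈ C := fun k => (hgC _).2 (by rw [hg])
  have hex : ∀ z, ∃ y, (0, y, z) ∈ S := by
    intro z
    obtain ⟨⟨x, y, z'⟩, hs, c, hc, hsc⟩ := exists_add_eq_of_isComplement h (0, 0, z)
    have : z' = z := by simpa [hz c hc] using congrArg (fun x : Zpqq p q => x.2.2) hsc
    exact ⟨y, this ▸ hmem _ _ _ hs⟩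
  -- after a shift along `ℤ_p`, two such elements of `S` differ by an element of `C`
  have huniq : ∀ x y y' z, (x, y, z) ∈ S → (x, y', z) ∈ S → y = y' := by
    intro x y y' z hy hy'
    have h1 := (eq_and_eq_of_isComplement h (hmem x (x - (g (y' - y)).1) _ hy) hy'
      (hgmem (y' - y)) h0C
      (by ext <;> simp [hg, hz _ (hgmem (y' - y))])).2
    have h2 := hg (y' - y)
    rw [h1] at h2
    exact (sub_eq_zero.1 h2.symm).symm
  choose a ha using hex
  refine Or.inr (Or.inr (Or.inl ⟨h3, a, fun i => (g i).1, huniq _ _ _ _ (ha 0) h0S,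
    by simp [hg0], ?_, ?_⟩))
  · ext ⟨x, y, z⟩
    constructor
    · exact fun hx => huniq _ _ _ _ (hmem x 0 _ hx) (ha z)
    · intro hy
      obtain rfl : y = a z := hy
      exact hmem _ _ _ (ha z)
  · ext x
    constructor
    · intro hx
      exact ⟨congrArg Prod.fst ((hgC x).1 hx).symm, hz x hx⟩
    · rintro ⟨h1, h2⟩
      rw [hgC]
      ext
      · exact h1.symm
      · exact hg _
      · rw [h2, hz _ (hgmem _)]

/-- Family 4: the second coordinate is a direction of periodicity of `S`, and `C` lies in
`{0} × ℤ_q × ℤ_q`. -/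
theorem isStandardTablePair_of_e2_periodic_of_fst_eq_zero (h : IsComplement S C) (h0S : 0 ∈ S)
    (h0C : 0 ∈ C) (hS : e2 p q ∈ stabilizer (Zpqq p q) S)
    (hC : Nat.card C = q) (hx : ∀ x ∈ C, x.1 = 0)
    (hinj : Set.InjOn (fun x : Zpqq p q => x.2.2) C) : IsStandardTablePair p q S C := by
  obtain ⟨g, hg, hgC⟩ := exists_section hinj (by simp [hC])
  have hg0 : g 0 = 0 := (hgC 0).1 h0C
  have hmem : ∀ x y y' z, (x, y, z) ∈ S → (x, y', z) ∈ S := fun x y y' z hx => by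
    simpa using (add_mem_iff (mk_mem_stabilizer_of_e2_mem hS (y' - y)) _).2 hx
  have hgmem : ∀ k, g k ∈ C := fun k => (hgC _).2 (by rw [hg])
  have hex : ∀ x, ∃ z, (x, 0, z) ∈ S := by
    intro x
    obtain ⟨⟨x', y, z⟩, hs, c, hc, hsc⟩ := exists_add_eq_of_isComplement h (x, 0, 0)
    have : x' = x := by simpa [hx c hc] using congrArg (fun x : Zpqq p q => x.1) hsc
    exact ⟨z, this ▸ hmem _ _ _ _ hs⟩
  -- after a shift along `e2`, two such elements of `S` differ by an element of `C`
  have huniq : ∀ x y z z', (x, y, z) ∈ S → (x, y, z') ∈ S → z = z' := by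
    intro x y z z' hz hz'
    have h1 := (eq_and_eq_of_isComplement h (hmem x y (y - (g (z' - z)).2.1) z hz) hz'
      (hgmem (z' - z)) h0C
      (by ext <;> simp [hg, hx _ (hgmem (z' - z))])).2
    have h2 := hg (z' - z)
    rw [h1] at h2
    exact (sub_eq_zero.1 h2.symm).symm
  choose a ha using hex
  refine Or.inr (Or.inr (Or.inr (Or.inl ⟨a, fun i => (g i).2.1, huniq _ _ _ _ (ha 0) h0S,
    by simp [hg0], ?_, ?_⟩)))
  · ext ⟨x, y, z⟩
    constructor
    · exact fun hx => huniq _ _ _ _ (hmem x y 0 z hx) (ha x)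
    · intro hz
      obtain rfl : z = a x := hz
      exact hmem _ _ _ _ (ha x)
  · ext x
    constructor
    · intro h1
      exact ⟨hx x h1, congrArg (fun x : Zpqq p q => x.2.1) ((hgC x).1 h1).symm⟩
    · rintro ⟨h1, h2⟩
      rw [hgC]
      ext
      · rw [h1, hx _ (hgmem _)]
      · exact h2.symm
      · exact hg _

/-- Family 5: `C` is the subgroup generated by `e2`. -/
theorem isStandardTablePair_of_subset_zmultiples_e2 (h : IsComplement S C) (h0S : 0 ∈ S)
    (h0C : 0 ∈ C) (hS : Nat.card S = p * q) (hC : Nat.card C = q)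
    (hx : ∀ x ∈ C, x.1 = 0 ∧ x.2.2 = 0) :
    IsStandardTablePair p q S C := by
  obtain ⟨c, hc, hcC⟩ := exists_section (A := C) (f := fun x : Zpqq p q => x.2.1)
    (fun x hxC y hyC hxy => by
      ext
      · rw [(hx x hxC).1, (hx y hyC).1]
      · exact hxy
      · rw [(hx x hxC).2, (hx y hyC).2]) (by simp [hC])
  have hC' : C = {x | x.1 = 0 ∧ x.2.2 = 0} := by
    refine Set.Subset.antisymm hx fun x ⟨h1, h2⟩ => (hcC x).2 ?_
    have := hx (c x.2.1) ((hcC _).2 (by rw [hc]))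
    ext
    · rw [this.1, h1]
    · exact hc _
    · rw [this.2, h2]
  obtain ⟨g, hg, hgS⟩ := exists_section (A := S) (f := fun x : Zpqq p q => (x.1, x.2.2))
    (fun x hxS y hyS hxy => by
      simp only [Prod.mk.injEq] at hxy
      exact (eq_and_eq_of_isComplement h hxS hyS h0C (c' := x - y)
        (by rw [hC']; simp [hxy]) (by abel)).1)
    (by simp [hS])
  have hg0 : g (0, 0) = 0 := (hgS 0).1 h0S
  refine Or.inr (Or.inr (Or.inr (Or.inr (Or.inl
    ⟨fun i j => (g (i, j)).2.1, by simp [hg0], ?_, hC'⟩))))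
  ext x
  have h1 := hg (x.1, x.2.2)
  simp only [Prod.mk.injEq] at h1
  rw [hgS, Prod.ext_iff, Prod.ext_iff]
  simp [h1, eq_comm]

/-- Family 6: the second coordinate is a direction of periodicity of `S`, and `C` lies in
`ℤ_p × ℤ_q × {0}`. -/
theorem isStandardTablePair_of_e2_periodic_of_last_eq_zero (h0S : 0 ∈ S) (h0C : 0 ∈ C)
    (hS : Nat.card S = q ^ 2) (hSinj : Set.InjOn Prod.snd S)
    (hstab : e2 p q ∈ stabilizer (Zpqq p q) S) (hC : Nat.card C = p)
    (hCinj : Set.InjOn Prod.fst C) (hz : ∀ x ∈ C, x.2.2 = 0) :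
    IsStandardTablePair p q S C := by
  obtain ⟨g, hg, hgS⟩ := exists_section hSinj (by simp [hS, sq])
  obtain ⟨c, hc, hcC⟩ := exists_section hCinj (by simp [hC])
  have hg0 : g (0, 0) = 0 := (hgS 0).1 h0S
  have hc0 : c 0 = 0 := (hcC 0).1 h0C
  have hgy : ∀ y z, (g (y, z)).1 = (g (0, z)).1 := by
    intro y z
    have h1 : g (0, z) ∈ S := (hgS _).2 (by rw [hg])
    have h2 := (hgS _).1 ((add_mem_iff (mk_mem_stabilizer_of_e2_mem hstab y) _).2 h1)
    have h3 : ((0, y, 0) + g (0, z)).2 = (y, z) := by simp [hg]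
    rw [h3] at h2
    simp [h2]
  refine Or.inr (Or.inr (Or.inr (Or.inr (Or.inr (Or.inl
    ⟨fun z => (g (0, z)).1, fun x => (c x).2.1, by simp [hg0], by simp [hc0], ?_, ?_⟩)))))
  · ext ⟨x, y, z⟩
    rw [hgS, Prod.ext_iff]
    simp [hg, hgy y z, eq_comm]
  · ext x
    have hcx := hz (c x.1) ((hcC _).2 (by rw [hc]))
    rw [hcC, Prod.ext_iff, Prod.ext_iff]
    simp [hc, hcx, eq_comm]

/-- Family 7: `C` is the subgroup `ℤ_p`. -/
theorem isStandardTablePair_of_snd_eq_zero (h0S : 0 ∈ S)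
    (hS : Nat.card S = q ^ 2) (hSinj : Set.InjOn Prod.snd S) (hC : Nat.card C = p)
    (hz : ∀ x ∈ C, x.2 = 0) : IsStandardTablePair p q S C := by
  obtain ⟨g, hg, hgS⟩ := exists_section hSinj (by simp [hS, sq])
  obtain ⟨c, hc, hcC⟩ := exists_section (A := C) (f := fun x : Zpqq p q => x.1)
    (fun x hx y hy hxy => Prod.ext hxy (by rw [hz x hx, hz y hy])) (by simp [hC])
  have hg0 : g (0, 0) = 0 := (hgS 0).1 h0S
  refine Or.inr (Or.inr (Or.inr (Or.inr (Or.inr (Or.inr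
    ⟨fun y z => (g (y, z)).1, by simp [hg0], ?_, ?_⟩)))))
  · ext ⟨x, y, z⟩
    rw [hgS, Prod.ext_iff]
    simp [hg, eq_comm]
  · ext x
    have hcx := hz (c x.1) ((hcC _).2 (by rw [hc]))
    rw [hcC, Prod.ext_iff]
    simp [hc, hcx, eq_comm, Prod.ext_iff]

end StandardFamilies

/-! ### Classification of the tilings -/

section Classification

open AddSubgroup AddAction Pointwise

variable {p q : ℕ} [Fact p.Prime] [Fact q.Prime] {S C : Set (Zpqq p q)}

theorem exists_fst_ne_zero (hgen : AddSubgroup.closure S = ⊤) : ∃ x ∈ S, x.1 ≠ 0 := by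
  by_contra! hS
  have hle : AddSubgroup.closure S ≤ (AddMonoidHom.fst (ZMod p) (ZMod q × ZMod q)).ker :=
    (closure_le _).2 fun x hx => hS x hx
  rw [hgen] at hle
  have : (1 : ZMod p) = 0 := hle (mem_top (1, 0))
  exact one_ne_zero this

theorem addOrderOf_eq_of_ne_zero {w : ZMod q × ZMod q} (hw : w ≠ 0) : addOrderOf w = q :=
  addOrderOf_eq_prime (by ext <;> simp) hw

/-- A generating set does not project into a cyclic subgroup of `ℤ_q × ℤ_q`. -/
theorem exists_snd_notMem_zmultiples (hgen : AddSubgroup.closure S = ⊤) (w : ZMod q × ZMod q) :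
    ∃ x ∈ S, x.2 ∉ zmultiples w := by
  have hq : q.Prime := Fact.out
  by_contra! hS
  have hle : AddSubgroup.closure S ≤
      (zmultiples w).comap (AddMonoidHom.snd (ZMod p) (ZMod q × ZMod q)) :=
    (closure_le _).2 fun x hx => hS x hx
  rw [hgen] at hle
  have htop : zmultiples w = ⊤ := eq_top_iff.2 fun y _ => hle (mem_top (0, y))
  have hcard : addOrderOf w = q * q := by
    rw [← Nat.card_zmultiples, htop]
    simp
  have hle : addOrderOf w ∣ q := addOrderOf_dvd_of_nsmul_eq_zero (by ext <;> simp)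
  rw [hcard] at hle
  nlinarith [Nat.le_of_dvd hq.pos hle, hq.two_le]

theorem eq_top_of_notMem_zmultiples {K : AddSubgroup (ZMod q × ZMod q)} {v w : ZMod q × ZMod q}
    (hw : w ∈ K) (hw0 : w ≠ 0) (hv : v ∈ K) (hvw : v ∉ zmultiples w) : K = ⊤ := by
  have hq : q.Prime := Fact.out
  have hle : zmultiples w ≤ K := by simpa using hw
  have hw' : Nat.card (zmultiples w) = q := by
    rw [Nat.card_zmultiples, addOrderOf_eq_of_ne_zero hw0]
  have hH : Nat.card (ZMod q × ZMod q) = q ^ 2 := by simp [sq]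
  obtain ⟨n, hn, hKn⟩ := (Nat.dvd_prime_pow hq).1 (hH ▸ card_addSubgroup_dvd_card K)
  have hne : Nat.card K ≠ q := fun h => hvw <| by
    rw [eq_of_le_of_card_ge hle (by rw [hw', h])]
    exact hv
  have hqK := card_dvd_of_le hle
  rw [hw'] at hqK
  interval_cases n
  · rw [hKn, pow_zero, Nat.dvd_one] at hqK
    exact absurd hqK hq.one_lt.ne'
  · exact absurd (by simpa using hKn) hne
  · exact eq_top_of_card_eq K (by rw [hKn, hH])

theorem sndEquiv_mem_stabilizer_image {M : (ZMod q × ZMod q) ≃+ (ZMod q × ZMod q)} {g : Zpqq p q}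
    (h : g ∈ stabilizer (Zpqq p q) S) :
    sndEquiv M g ∈ stabilizer (Zpqq p q) (sndEquiv M '' S) := by
  rw [mem_stabilizer_set' (Set.toFinite _)]
  rintro _ ⟨x, hx, rfl⟩
  exact ⟨g + x, (add_mem_iff h x).2 hx, by rw [map_add, vadd_eq_add]⟩

omit [Fact p.Prime] in
theorem card_sndEquiv_image (M : (ZMod q × ZMod q) ≃+ (ZMod q × ZMod q)) :
    Nat.card (sndEquiv M '' S) = Nat.card S :=
  Nat.card_image_of_injective (sndEquiv M).injective S

theorem zero_mem_sndEquiv_image (M : (ZMod q × ZMod q) ≃+ (ZMod q × ZMod q)) (h : 0 ∈ S) :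
    (0 : Zpqq p q) ∈ sndEquiv M '' S :=
  ⟨0, h, map_zero _⟩

theorem apply_snd_eq_zero_of_mem_zmultiples {M : (ZMod q × ZMod q) ≃+ (ZMod q × ZMod q)}
    {w y : ZMod q × ZMod q} (hM : M w = (1, 0)) (hy : y ∈ zmultiples w) : (M y).2 = 0 := by
  obtain ⟨k, rfl⟩ := mem_zmultiples_iff.1 hy
  rw [map_zsmul, hM]
  simp

/-- The stabilizer of `B`, restricted to `{0} × ℤ_q × ℤ_q`. -/
def sndStabilizer (B : Set (Zpqq p q)) : AddSubgroup (ZMod q × ZMod q) :=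
  (stabilizer (Zpqq p q) B).comap (AddMonoidHom.inr (ZMod p) (ZMod q × ZMod q))

/-- Since `S` generates the group, all of `{0} × ℤ_q × ℤ_q` consists of periods of `C`. -/
theorem isInTable_of_card_left_eq_p (hpq : p ≠ q) (h : IsComplement S C) (h0S : 0 ∈ S)
    (h0C : 0 ∈ C) (hgen : AddSubgroup.closure S = ⊤) (hS : Nat.card S = p) : IsInTable S C := by
  refine (isStandardTablePair_of_ker_fst_subset h h0S hS ?_).isInTable hpq
  have hst : ∀ s ∈ S, s.2 ∈ sndStabilizer C := fun s hs => snd_mem_stabilizer h hpq hS h0S hs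
  have htop : sndStabilizer C = ⊤ := by
    obtain ⟨s, hs, hs0⟩ := exists_snd_notMem_zmultiples hgen 0
    obtain ⟨t, ht, hts⟩ := exists_snd_notMem_zmultiples hgen s.2
    exact eq_top_of_notMem_zmultiples (hst s hs) (by simpa using hs0) (hst t ht) hts
  rintro ⟨x, y⟩ rfl
  have : y ∈ sndStabilizer C := htop ▸ mem_top y
  simpa using (add_mem_iff this 0).2 h0C

/-- The second components of the elements of `C` are periods of `S`. They lie in a cyclic subgroup,
since otherwise `S` would be the proper subgroup `{0} × ℤ_q × ℤ_q`; the trivial subgroup gives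
family 7 of `IsTablePair` and a subgroup of order `q` family 6. -/
theorem isInTable_of_card_right_eq_p (hpq : p ≠ q) (h : IsComplement S C) (h0S : 0 ∈ S)
    (h0C : 0 ∈ C) (hgen : AddSubgroup.closure S = ⊤) (hS : Nat.card S = q ^ 2)
    (hC : Nat.card C = p) : IsInTable S C := by
  have hSinj := injOn_snd h hpq hS
  have hst : ∀ c ∈ C, c.2 ∈ sndStabilizer S := fun c hc =>
    snd_mem_stabilizer (isComplement_symm h) hpq hC h0C hc
  by_cases hw : ∀ c ∈ C, c.2 = 0
  · exact (isStandardTablePair_of_snd_eq_zero h0S hS hSinj hC hw).isInTable hpq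
  push Not at hw
  obtain ⟨w, hwC, hw0⟩ := hw
  have hwz : ∀ c ∈ C, c.2 ∈ zmultiples w.2 := by
    by_contra! hc
    obtain ⟨c, hcC, hcw⟩ := hc
    have htop := eq_top_of_notMem_zmultiples (hst w hwC) hw0 (hst c hcC) hcw
    obtain ⟨s, hs, hs1⟩ := exists_fst_ne_zero hgen
    -- `S` contains `{0} × ℤ_q × ℤ_q`, and the second projection is injective on `S`
    have hs2 : (0, s.2) ∈ S := by
      have : s.2 ∈ sndStabilizer S := htop ▸ mem_top s.2
      simpa using (add_mem_iff this 0).2 h0S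
    exact hs1 (congrArg Prod.fst (hSinj hs hs2 rfl))
  obtain ⟨M, hM⟩ := exists_addEquiv_apply_eq hw0
  refine IsInTable.of_image (M := M) (IsStandardTablePair.isInTable hpq ?_)
  have h' := isComplement_image (sndEquiv M) h
  have hS' : Nat.card (sndEquiv M '' S) = q ^ 2 := by rw [card_sndEquiv_image, hS]
  have hC' : Nat.card (sndEquiv M '' C) = p := by rw [card_sndEquiv_image, hC]
  refine isStandardTablePair_of_e2_periodic_of_last_eq_zero (zero_mem_sndEquiv_image M h0S)
    (zero_mem_sndEquiv_image M h0C) hS' (injOn_snd h' hpq hS') ?_ hC'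
    (injOn_fst (isComplement_symm h') hpq hC') ?_
  · have := sndEquiv_mem_stabilizer_image (M := M) (hst w hwC)
    simp only [sndEquiv_apply, AddMonoidHom.inr_apply, hM] at this
    exact this
  · rintro _ ⟨c, hc, rfl⟩
    exact apply_snd_eq_zero_of_mem_zmultiples hM (hwz c hc)

theorem exists_eq_pair {α : Type*} {A : Set α} {a : α} (ha : a ∈ A) (hA : Nat.card A = 2) :
    ∃ b, b ≠ a ∧ A = {a, b} := by
  have : (A \ {a}).ncard = 1 := by
    rw [Set.ncard_sdiff_singleton_of_mem ha, ← Nat.card_coe_set_eq, hA]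
  obtain ⟨b, hb⟩ := Set.ncard_eq_one.1 this
  have hbA : b ∈ A \ {a} := by simp [hb]
  exact ⟨b, hbA.2, by rw [← hb, Set.insert_sdiff_singleton, Set.insert_eq_of_mem ha]⟩

theorem exists_eq_triple {α : Type*} {A : Set α} {a : α} (ha : a ∈ A) (hA : Nat.card A = 3) :
    ∃ b c, b ≠ a ∧ c ≠ a ∧ b ≠ c ∧ A = {a, b, c} := by
  have : (A \ {a}).ncard = 2 := by
    rw [Set.ncard_sdiff_singleton_of_mem ha, ← Nat.card_coe_set_eq, hA]
  obtain ⟨b, c, hbc, h⟩ := Set.ncard_eq_two.1 this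
  have hb : b ∈ A \ {a} := by simp [h]
  have hc : c ∈ A \ {a} := by simp [h]
  exact ⟨b, c, hb.2, hc.2, hbc, by
    rw [← h, Set.insert_sdiff_singleton, Set.insert_eq_of_mem ha]⟩

/-- If the first coordinates of a three-element factor containing `0` do not all vanish, the
other factor is a union of cosets of `ℤ_p`. -/
theorem mk_zero_mem_stabilizer_of_triple {A B : Set (Zpqq p q)} (h : IsComplement A B)
    (hpq : p ≠ q) {n : ℕ} (hcard : Nat.card A = q ^ n) {c d : Zpqq p q} (hA : A = {0, c, d})
    (hcd : c.1 ≠ 0 ∨ d.1 ≠ 0) (i : ZMod p) : (i, 0) ∈ stabilizer (Zpqq p q) B := by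
  by_cases hc : c.1 = 0
  · refine mk_zero_mem_stabilizer_of_unique_fst_ne_zero h hpq hcard (a := d) (by simp [hA])
      (by tauto) ?_ i
    rw [hA]
    rintro b (rfl | rfl | rfl) hb <;> simp_all
  by_cases hd : d.1 = 0
  · refine mk_zero_mem_stabilizer_of_unique_fst_ne_zero h hpq hcard (a := c) (by simp [hA])
      hc ?_ i
    rw [hA]
    rintro b (rfl | rfl | rfl) hb <;> simp_all
  · refine mk_zero_mem_stabilizer_of_fst_ne_zero h hpq hcard (by simp [hA]) ?_ i
    rw [hA]
    rintro b (rfl | rfl | rfl) hb <;> simp_all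

/-- With `S = {0, s, t}`, the periods of `C` include `ℤ_p` and `s.2 + t.2`, which is nonzero because
`S` generates the group; this is family 2 of `IsTablePair`, with `s.2 + t.2` as `v₂`. -/
theorem isInTable_of_card_left_eq_three {S C : Set (Zpqq p 3)} (hpq : p ≠ 3) (h : IsComplement S C)
    (h0S : 0 ∈ S) (h0C : 0 ∈ C) (hgen : AddSubgroup.closure S = ⊤) (hS : Nat.card S = 3) :
    IsInTable S C := by
  have : Fact (Nat.Prime 3) := ⟨Nat.prime_three⟩
  obtain ⟨s, t, hs, ht, hst, hSst⟩ := exists_eq_triple h0S hS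
  have hw := snd_add_snd_mem_stabilizer h hpq hSst hst hs ht
  have hw0 : s.2 + t.2 ≠ 0 := by
    intro hw0
    obtain ⟨x, hx, hxs⟩ := exists_snd_notMem_zmultiples hgen s.2
    rw [hSst] at hx
    rcases hx with rfl | rfl | rfl
    · exact hxs (zero_mem _)
    · exact hxs (mem_zmultiples _)
    · exact hxs (by rw [← neg_eq_of_add_eq_zero_right hw0]; exact neg_mem (mem_zmultiples _))
  have hp := mk_zero_mem_stabilizer_of_triple h hpq (n := 1) (by simpa using hS) hSst (by
    by_contra! hcon
    obtain ⟨x, hx, hx1⟩ := exists_fst_ne_zero hgen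
    rw [hSst] at hx
    rcases hx with rfl | rfl | rfl <;> simp_all)
  obtain ⟨M, hM⟩ := exists_addEquiv_apply_eq hw0
  refine IsInTable.of_image (M := M) (IsStandardTablePair.isInTable hpq ?_)
  refine isStandardTablePair_of_ker_last_subset rfl (isComplement_image (sndEquiv M) h)
    (zero_mem_sndEquiv_image M h0S) (by rw [card_sndEquiv_image, hS]) ?_
  rintro ⟨x, y, z⟩ rfl
  have h1 := sndEquiv_mem_stabilizer_image (M := M) hw
  have h2 := sndEquiv_mem_stabilizer_image (M := M) (hp x)
  simp only [sndEquiv_apply, hM, map_zero] at h1 h2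
  have h3 := (add_mem_iff (add_mem h2 (mk_mem_stabilizer_of_e2_mem h1 y)) 0).2
    (zero_mem_sndEquiv_image M h0C)
  simpa using h3

/-- A factor of order `q` contained in a cyclic subgroup of `{0} × ℤ_q × ℤ_q`. -/
theorem isInTable_of_snd_mem_zmultiples (hpq : p ≠ q) (h : IsComplement S C) (h0S : 0 ∈ S)
    (h0C : 0 ∈ C) (hS : Nat.card S = p * q) (hC : Nat.card C = q) {w : ZMod q × ZMod q}
    (hw : w ≠ 0) (hCw : ∀ c ∈ C, c.1 = 0 ∧ c.2 ∈ zmultiples w) : IsInTable S C := by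
  obtain ⟨M, hM⟩ := exists_addEquiv_apply_eq hw
  refine IsInTable.of_image (M := M) (IsStandardTablePair.isInTable hpq ?_)
  refine isStandardTablePair_of_subset_zmultiples_e2 (isComplement_image (sndEquiv M) h)
    (zero_mem_sndEquiv_image M h0S) (zero_mem_sndEquiv_image M h0C)
    (by rw [card_sndEquiv_image, hS]) (by rw [card_sndEquiv_image, hC]) ?_
  rintro _ ⟨c, hc, rfl⟩
  exact ⟨(hCw c hc).1, apply_snd_eq_zero_of_mem_zmultiples hM (hCw c hc).2⟩

/-- The set of second components of a `ℤ_p`-periodic set of order `p * q` has order `q`. -/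
theorem card_snd_image (hS : Nat.card S = p * q)
    (hst : ∀ i : ZMod p, (i, 0) ∈ stabilizer (Zpqq p q) S) : Nat.card (Prod.snd '' S) = q := by
  have hp : p.Prime := Fact.out
  have hprod : S = (Set.univ : Set (ZMod p)) ×ˢ (Prod.snd '' S) := by
    ext ⟨x, y⟩
    simp only [Set.mem_prod, Set.mem_univ, true_and, Set.mem_image, Prod.exists, exists_eq_right]
    exact ⟨fun h => ⟨x, h⟩, fun ⟨x', h⟩ => by simpa using (add_mem_iff (hst (x - x')) _).2 h⟩
  have h1 := congrArg Set.ncard hprod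
  rw [Set.ncard_prod, Set.ncard_univ, Nat.card_zmod] at h1
  rw [← Nat.card_coe_set_eq, hS] at h1
  exact (Nat.eq_of_mul_eq_mul_left hp.pos h1).symm

/-- If the nonzero element of `C` is not in `{0} × ℤ_2 × ℤ_2`, then `S` is a union of two cosets of
`ℤ_p` and cannot generate the group. Otherwise family 5 of `IsTablePair` arises. -/
theorem isInTable_of_card_right_eq_two {S C : Set (Zpqq p 2)} (hpq : p ≠ 2) (h : IsComplement S C)
    (h0S : 0 ∈ S) (h0C : 0 ∈ C) (hgen : AddSubgroup.closure S = ⊤) (hS : Nat.card S = p * 2)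
    (hC : Nat.card C = 2) : IsInTable S C := by
  have : Fact (Nat.Prime 2) := ⟨Nat.prime_two⟩
  obtain ⟨c, hc, hCc⟩ := exists_eq_pair h0C hC
  by_cases hc1 : c.1 = 0
  · refine isInTable_of_snd_mem_zmultiples hpq h h0S h0C hS hC (w := c.2)
      (fun hc2 => hc (Prod.ext hc1 hc2)) ?_
    rw [hCc]
    rintro _ (rfl | rfl)
    · exact ⟨rfl, zero_mem _⟩
    · exact ⟨hc1, mem_zmultiples _⟩
  · have hst := mk_zero_mem_stabilizer_of_fst_ne_zero (isComplement_symm h) hpq (n := 1)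
      (by simpa using hC) h0C (by
        rw [hCc]
        rintro b (rfl | rfl) hb <;> simp_all)
    obtain ⟨s, -, hs⟩ := exists_eq_pair (a := 0)
      (show (0 : ZMod 2 × ZMod 2) ∈ Prod.snd '' S from ⟨0, h0S, rfl⟩) (card_snd_image hS hst)
    obtain ⟨x, hx, hxs⟩ := exists_snd_notMem_zmultiples hgen s
    have : x.2 ∈ Prod.snd '' S := ⟨x, hx, rfl⟩
    rw [hs] at this
    rcases this with h1 | h1 <;> rw [h1] at hxs
    · exact absurd (zero_mem _) hxs
    · exact absurd (mem_zmultiples _) hxs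

theorem injOn_image_triple {α β γ : Type*} {L : α → β} {f : β → γ} {a b c : α}
    (hab : f (L a) ≠ f (L b)) (hac : f (L a) ≠ f (L c)) (hbc : f (L b) ≠ f (L c)) :
    Set.InjOn f (L '' {a, b, c}) := by
  rintro _ ⟨x, rfl | rfl | rfl, rfl⟩ _ ⟨y, rfl | rfl | rfl, rfl⟩ hxy
  exacts [rfl, absurd hxy hab, absurd hxy hac, absurd hxy.symm hab, rfl, absurd hxy hbc,
    absurd hxy.symm hac, absurd hxy.symm hbc, rfl]

theorem one_ne_neg_one_zmod_three : (1 : ZMod 3) ≠ -1 := by decide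

theorem snd_ne_zero_of_add_eq_one_zero : ∀ u v : ZMod 3 × ZMod 3,
    u ≠ 0 ∧ v ≠ 0 ∧ u ≠ v ∧ u + v = (1, 0) → u.2 ≠ 0 ∧ v.2 ≠ 0 ∧ u.2 ≠ v.2 := by
  decide

/-- With `C = {0, c, d}`, the sum `c.2 + d.2` is a period of `S`. If `C` lies in
`{0} × ℤ_3 × ℤ_3`, a zero sum gives family 5 of `IsTablePair` and a nonzero sum family 4. Otherwise
`S` is also `ℤ_p`-periodic; were the sum nonzero, `S` would be the proper subgroup that the sum
generates together with `ℤ_p`. So the sum is zero, and family 3 arises with `c.2` as `v₂`. -/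
theorem isInTable_of_card_right_eq_three {S C : Set (Zpqq p 3)} (hpq : p ≠ 3) (h : IsComplement S C)
    (h0S : 0 ∈ S) (h0C : 0 ∈ C) (hgen : AddSubgroup.closure S = ⊤) (hS : Nat.card S = p * 3)
    (hC : Nat.card C = 3) : IsInTable S C := by
  have : Fact (Nat.Prime 3) := ⟨Nat.prime_three⟩
  have hsymm := isComplement_symm h
  obtain ⟨c, d, hc, hd, hcd, hCcd⟩ := exists_eq_triple h0C hC
  have hw := snd_add_snd_mem_stabilizer hsymm hpq hCcd hcd hc hd
  by_cases hcd1 : c.1 = 0 ∧ d.1 = 0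
  · obtain ⟨hc1, hd1⟩ := hcd1
    by_cases hw0 : c.2 + d.2 = 0
    · refine isInTable_of_snd_mem_zmultiples hpq h h0S h0C hS hC (w := c.2)
        (fun hc2 => hc (Prod.ext hc1 hc2)) ?_
      rw [hCcd]
      rintro _ (rfl | rfl | rfl)
      · exact ⟨rfl, zero_mem _⟩
      · exact ⟨hc1, mem_zmultiples _⟩
      · exact ⟨hd1, by rw [← neg_eq_of_add_eq_zero_right hw0]; exact neg_mem (mem_zmultiples _)⟩
    · obtain ⟨M, hM⟩ := exists_addEquiv_apply_eq hw0
      refine IsInTable.of_image (M := M) (IsStandardTablePair.isInTable hpq ?_)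
      have hst := sndEquiv_mem_stabilizer_image (M := M) hw
      simp only [sndEquiv_apply, hM] at hst
      refine isStandardTablePair_of_e2_periodic_of_fst_eq_zero (isComplement_image (sndEquiv M) h)
        (zero_mem_sndEquiv_image M h0S) (zero_mem_sndEquiv_image M h0C) hst
        (by rw [card_sndEquiv_image, hC]) ?_ ?_
      · rintro _ ⟨x, hx, rfl⟩
        rw [hCcd] at hx
        rcases hx with rfl | rfl | rfl <;> simp_all
      · -- the last coordinates of `0`, `M c.2` and `M d.2` are pairwise distinct
        have hcM : M c.2 ≠ 0 := fun h0 => hc (Prod.ext hc1 (by simpa using h0))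
        have hdM : M d.2 ≠ 0 := fun h0 => hd (Prod.ext hd1 (by simpa using h0))
        have hne : M c.2 ≠ M d.2 := fun h0 => hcd (Prod.ext (hc1.trans hd1.symm) (M.injective h0))
        obtain ⟨k1, k2, k3⟩ := snd_ne_zero_of_add_eq_one_zero _ _
          ⟨hcM, hdM, hne, by rw [← map_add, hM]⟩
        rw [hCcd]
        exact injOn_image_triple (by simpa using k1.symm) (by simpa using k2.symm) k3
  · have hst := mk_zero_mem_stabilizer_of_triple hsymm hpq (n := 1) (by simpa using hC) hCcd
      (by tauto)
    have hCinj := injOn_snd hsymm hpq (n := 1) (by simpa using hC)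
    have hw0 : c.2 + d.2 = 0 := by
      by_contra hw0
      obtain ⟨x, hx, hxw⟩ := exists_snd_notMem_zmultiples hgen (c.2 + d.2)
      have hle : (zmultiples (c.2 + d.2) : Set (ZMod 3 × ZMod 3)) ⊆ Prod.snd '' S := by
        intro y hy
        have hle' : zmultiples (c.2 + d.2) ≤ sndStabilizer S := by
          rw [zmultiples_le]
          exact hw
        exact ⟨(0, y), by simpa using (add_mem_iff (hle' hy) 0).2 h0S, rfl⟩
      have heq := Set.eq_of_subset_of_ncard_le hle (by
        rw [← Nat.card_coe_set_eq, ← Nat.card_coe_set_eq, card_snd_image hS hst]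
        exact (Nat.card_zmultiples _).trans (addOrderOf_eq_of_ne_zero hw0) |>.ge)
      exact hxw (heq ▸ ⟨x, hx, rfl⟩ : x.2 ∈ (zmultiples (c.2 + d.2) : Set _))
    have hc2 : c.2 ≠ 0 := fun h0 => hc (hCinj (by simp [hCcd]) h0C h0)
    obtain ⟨M, hM⟩ := exists_addEquiv_apply_eq hc2
    have hdc : d.2 = -c.2 := (neg_eq_of_add_eq_zero_right hw0).symm
    refine IsInTable.of_image (M := M) (IsStandardTablePair.isInTable hpq ?_)
    refine isStandardTablePair_of_fst_periodic rfl (isComplement_image (sndEquiv M) h)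
      (zero_mem_sndEquiv_image M h0S) (zero_mem_sndEquiv_image M h0C)
      (fun i => by simpa using sndEquiv_mem_stabilizer_image (M := M) (hst i))
      (by rw [card_sndEquiv_image, hC]) ?_ ?_
    · rintro _ ⟨x, hx, rfl⟩
      rw [hCcd] at hx
      rcases hx with rfl | rfl | rfl <;> simp_all
    · rw [hCcd]
      refine injOn_image_triple ?_ ?_ ?_ <;> simp [hM, hdc, one_ne_neg_one_zmod_three]

theorem card_ne_two_of_closure_eq_top {S : Set (Zpqq p q)} (h0S : 0 ∈ S)
    (hgen : AddSubgroup.closure S = ⊤) : Nat.card S ≠ 2 := by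
  intro hS
  obtain ⟨s, -, hs⟩ := exists_eq_pair h0S hS
  obtain ⟨x, hx, hxs⟩ := exists_snd_notMem_zmultiples hgen s.2
  rw [hs] at hx
  rcases hx with rfl | rfl
  · exact hxs (zero_mem _)
  · exact hxs (mem_zmultiples _)

theorem isInTable_of_isComplement (hpq : p ≠ q) (hq3 : q ≤ 3) (h : IsComplement S C) (h0S : 0 ∈ S)
    (h0C : 0 ∈ C) (hgen : AddSubgroup.closure S = ⊤) (hne : S ≠ Set.univ) : IsInTable S C := by
  have hp : p.Prime := Fact.out
  have hq : q.Prime := Fact.out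
  have hcard : Nat.card S * Nat.card C = p * q ^ 2 := by
    rw [h.card_mul_card]
    simp [sq]
  have hCpos : 0 < Nat.card C := Nat.pos_of_ne_zero fun h0 => by
    rw [h0, mul_zero] at hcard
    exact (mul_ne_zero hp.ne_zero (pow_ne_zero 2 hq.ne_zero)) hcard.symm
  have hq23 : q = 2 ∨ q = 3 := by
    have := hq.two_le
    omega
  obtain ⟨y, z, hy, hz, hyz⟩ := exists_dvd_and_dvd_of_dvd_mul (Dvd.intro _ hcard)
  obtain ⟨n, hn, rfl⟩ := (Nat.dvd_prime_pow hq).1 hz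
  rw [Nat.dvd_prime hp] at hy
  obtain ⟨s, hs, hs0⟩ := exists_fst_ne_zero hgen
  have hS1 : Nat.card S ≠ 1 := fun h1 => by
    obtain ⟨x, hx⟩ := Set.ncard_eq_one.1 h1
    rw [hx] at h0S hs
    obtain rfl : (0 : Zpqq p q) = x := h0S
    obtain rfl : s = 0 := hs
    exact hs0 rfl
  rcases hy with rfl | rfl
  · interval_cases n
    · simp_all
    · rcases hq23 with rfl | rfl
      · exact absurd (by simpa using hyz) (card_ne_two_of_closure_eq_top h0S hgen)
      · exact isInTable_of_card_left_eq_three hpq h h0S h0C hgen (by simpa using hyz)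
    · rw [one_mul] at hyz
      refine isInTable_of_card_right_eq_p hpq h h0S h0C hgen hyz ?_
      rw [hyz, mul_comm] at hcard
      exact Nat.eq_of_mul_eq_mul_right (pow_pos hq.pos 2) hcard
  · interval_cases n
    · exact isInTable_of_card_left_eq_p hpq h h0S h0C hgen (by simpa using hyz)
    · rw [pow_one] at hyz
      have hC : Nat.card C = q := by
        rw [hyz, sq, ← mul_assoc] at hcard
        exact Nat.eq_of_mul_eq_mul_left (mul_pos hp.pos hq.pos) hcard
      rcases hq23 with rfl | rfl
      · exact isInTable_of_card_right_eq_two hpq h h0S h0C hgen hyz hC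
      · exact isInTable_of_card_right_eq_three hpq h h0S h0C hgen hyz hC
    · refine absurd (Set.eq_of_subset_of_ncard_le (Set.subset_univ S) ?_) hne
      rw [Set.ncard_univ, ← Nat.card_coe_set_eq, hyz]
      simp [sq]

/-- A perfect code in a Cayley digraph is a tiling complement of the connection set together with
the identity. -/
theorem isPerfectCode_cayleyDigraph_iff {G : Type*} [AddGroup G] {S C : Set G} :
    IsPerfectCode (cayleyDigraph S) C ↔ IsComplement (S ∪ {0}) C := by
  rw [isComplement_iff_existsUnique_add_neg_mem]
  refine forall_congr' fun g => ?_
  have hiff : ∀ u, (u = g ∨ (cayleyDigraph S).Adj u g) ↔ g + -u ∈ S ∪ {0} := fun u => by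
    simp only [cayleyDigraph, sub_eq_add_neg, Set.union_singleton, Set.mem_insert_iff,
      add_neg_eq_zero, eq_comm (a := u)]
  simp only [hiff]
  constructor
  · rintro ⟨u, ⟨hu, hug⟩, huniq⟩
    exact ⟨⟨u, hu⟩, hug, fun v hv => Subtype.ext (huniq v ⟨v.2, hv⟩)⟩
  · rintro ⟨⟨u, hu⟩, hug, huniq⟩
    exact ⟨u, ⟨hu, hug⟩, fun v hv => congrArg Subtype.val (huniq ⟨v, hv.1⟩ hv.2)⟩

end Classification

theorem mainTheorem4 (p q : ℕ) (hp : p.Prime) (hq : q.Prime) (hpq : p ≠ q)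
    (hp3 : 3 ≤ p) (hq3 : q ≤ 3) (S C : Set (Zpqq p q))
    (hS : S ⊂ {0}ᶜ) (hgen : AddSubgroup.closure S = ⊤) (hC : (0 : Zpqq p q) ∈ C) :
    IsPerfectCode (cayleyDigraph S) C ↔
      ∃ v₂ v₃ : Zpqq p q, IsGeneratingPair v₂ v₃ ∧
        IsTablePair p q (e1 p q) v₂ v₃ (S ∪ {0}) C := by
  have := Fact.mk hp
  have := Fact.mk hq
  rw [isPerfectCode_cayleyDigraph_iff]
  constructor
  · intro h
    refine isInTable_of_isComplement hpq hq3 h (by simp) hC ?_ ?_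
    · exact top_le_iff.1 (hgen.ge.trans (AddSubgroup.closure_mono Set.subset_union_left))
    · intro huniv
      refine hS.2 fun x hx => ?_
      have : x ∈ S ∪ {0} := huniv ▸ Set.mem_univ x
      exact this.resolve_right hx
  · exact fun h => IsInTable.isComplement hpq h
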